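/- Let $N,n,m$ be positive integers, $T_h>0$, $\varepsilon>0$, and for $i=1,\dots,N$ let $A_i\in\mathbb R^{n\times n}$, $B_i\in\mathbb R^{n\times m}$ and $x_i^{\mathsf d}\in\mathbb R^n$. Assume that every pair $(A_i,B_i)$ is controllable and that for all $i,j$ there is $\bar u_{ij}\in\mathbb R^m$ with $A_ix_j^{\mathsf d}+B_i\bar u_{ij}=0$. Put $$\mathcal G_i:=\Bigl(\int_0^{T_h}e^{-A_it}B_iB_i^\top e^{-A_i^\top t}\,dt\Bigr)^{-1}.$$ For $x=[x_1;\dots;x_N]\in\mathbb R^{nN}$ let $P^*(x)$ be the unique minimizer of $$\sum_{i,j}C_{ij}(x)P_{ij}+\varepsilon\sum_{i,j}P_{ij}(\log P_{ij}-1),\qquad C_{ij}(x):=(x_i-x_j^{\mathsf d})^\top\mathcal G_i(x_i-x_j^{\mathsf d}),$$ over all nonnegative $N\times N$ matrices $P$ whose row sums and column sums are all equal to $1/N$ (with $0\log 0=0$), and let $x_i^{\mathrm{tmp}}(x):=N\sum_{j=1}^NP^*_{ij}(x)x_j^{\mathsf d}$. Let $$\mathcal M':=\bigl\{x\in\mathbb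 R^{nN}: B_i^\top\mathcal G_i(x_i-x_i^{\mathrm{tmp}}(x))=0,\ B_i^\top e^{-A_i^\top T_h}\mathcal G_i(x_i-x_i^{\mathrm{tmp}}(x))=0\ \text{ for all } i\bigr\}.$$ Call a set $S\subseteq\mathbb R^{nN}$ invariant for an autonomous differential equation if through every point of $S$ there is a solution defined on all of $\mathbb R$ and every such solution stays in $S$ for all $t\in\mathbb R$. Then among the subsets of $\mathcal M'$ that are invariant for $$\dot x_i=A_i\bigl(x_i-x_i^{\mathrm{tmp}}(x)\bigr),\qquad i=1,\dots,N,$$ there is a largest one, $L$. For every initial state $x^0\in\mathbb R^{nN}$, the closed-loop system $$\dot x_i=(A_i-B_iB_i^\top\mathcal G_i)\bigl(x_i-x_i^{\mathrm{tmp}}(x)\bigr),\qquad i=1,\dots,N,$$ has a solution on $[0,\infty)$ with $x(0)=x^0$, and every such solution converges to $L$, that is, $\operatorname{dist}(x(t),L)\to0$ as $t\to\infty$ (in particular $L\neq\emptyset$). -/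

import Mathlib

open Matrix Set

namespace SinkhornMPC

/-- Controllability of the linear system `ẋ = A x + B u`: every state can be steered to every
state in some finite time by a continuous input. -/
def IsControllable {n m : ℕ} (A : Matrix (Fin n) (Fin n) ℝ) (B : Matrix (Fin n) (Fin m) ℝ) :
    Prop :=
  ∀ x₀ x₁ : Fin n → ℝ, ∃ T : ℝ, 0 < T ∧ ∃ (u : ℝ → Fin m → ℝ) (x : ℝ → Fin n → ℝ),
    ContinuousOn u (Icc 0 T) ∧
    (∀ t ∈ Icc (0 : ℝ) T, HasDerivWithinAt x (A *ᵥ x t + B *ᵥ u t) (Icc 0 T) t) ∧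
    x 0 = x₀ ∧ x T = x₁

/-- The Gramian `∫₀ᵀ exp(-A t) B Bᵀ exp(-Aᵀ t) dt`, integrated entry by entry. -/
noncomputable def gramian {n m : ℕ} (A : Matrix (Fin n) (Fin n) ℝ)
    (B : Matrix (Fin n) (Fin m) ℝ) (T : ℝ) : Matrix (Fin n) (Fin n) ℝ :=
  Matrix.of fun a b => ∫ t in (0 : ℝ)..T,
    (NormedSpace.exp (-(t • A)) * B * Bᵀ * NormedSpace.exp (-(t • Aᵀ))) a b

/-- The inverse of the Gramian: the weight `𝒢` of the transport cost. -/
noncomputable def gramInv {n m : ℕ} (A : Matrix (Fin n) (Fin n) ℝ)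
    (B : Matrix (Fin n) (Fin m) ℝ) (T : ℝ) : Matrix (Fin n) (Fin n) ℝ :=
  (gramian A B T)⁻¹

/-- Coupling matrices: nonnegative `N × N` matrices, all of whose row and column sums
are `1 / N`. -/
def couplings (N : ℕ) : Set (Matrix (Fin N) (Fin N) ℝ) :=
  {P | (∀ i j, 0 ≤ P i j) ∧ (∀ i, ∑ j, P i j = 1 / (N : ℝ)) ∧ ∀ j, ∑ i, P i j = 1 / (N : ℝ)}

/-- The entropy `H(P) = -∑ P_ij (log P_ij - 1)` (with `0 log 0 = 0`). -/
noncomputable def entropy {N : ℕ} (P : Matrix (Fin N) (Fin N) ℝ) : ℝ :=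
  -∑ i, ∑ j, P i j * (Real.log (P i j) - 1)

/-- The objective of the entropic optimal transport problem. -/
noncomputable def entropicCost {N : ℕ} (ε : ℝ) (C P : Matrix (Fin N) (Fin N) ℝ) : ℝ :=
  (∑ i, ∑ j, C i j * P i j) - ε * entropy P

theorem continuous_entropicCost {N : ℕ} (ε : ℝ) (C : Matrix (Fin N) (Fin N) ℝ) :
    Continuous (entropicCost ε C) := by
  have he : ∀ i j : Fin N, Continuous fun P : Matrix (Fin N) (Fin N) ℝ => P i j :=
    fun i j => (continuous_apply j).comp (continuous_apply i)
  have hl : Continuous fun y : ℝ => y * (Real.log y - 1) := by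
    have h : (fun y : ℝ => y * (Real.log y - 1)) = fun y => y * Real.log y - y := by
      funext y; ring
    rw [h]
    exact Real.continuous_mul_log.sub continuous_id
  unfold entropicCost entropy
  refine Continuous.sub ?_ (continuous_const.mul (Continuous.neg ?_))
  · exact continuous_finsetSum _ fun i _ => continuous_finsetSum _ fun j _ =>
      continuous_const.mul (he i j)
  · exact continuous_finsetSum _ fun i _ => continuous_finsetSum _ fun j _ =>
      hl.comp (he i j)

theorem isCompact_couplings (N : ℕ) : IsCompact (couplings N) := by
  have he : ∀ i j : Fin N, Continuous fun P : Matrix (Fin N) (Fin N) ℝ => P i j :=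
    fun i j => (continuous_apply j).comp (continuous_apply i)
  have hbox : IsCompact (Set.pi univ fun _ : Fin N => Set.pi univ fun _ : Fin N =>
      Icc (0 : ℝ) (1 / (N : ℝ))) :=
    isCompact_univ_pi fun _ => isCompact_univ_pi fun _ => isCompact_Icc
  refine hbox.of_isClosed_subset ?_ ?_
  · have h1 : IsClosed {P : Matrix (Fin N) (Fin N) ℝ | ∀ i j, 0 ≤ P i j} := by
      simp only [ofPred_forall]
      exact isClosed_iInter fun i => isClosed_iInter fun j =>
        isClosed_le continuous_const (he i j)
    have h2 : IsClosed {P : Matrix (Fin N) (Fin N) ℝ | ∀ i, ∑ j, P i j = 1 / (N : ℝ)} := by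
      simp only [ofPred_forall]
      exact isClosed_iInter fun i =>
        isClosed_eq (continuous_finsetSum _ fun j _ => he i j) continuous_const
    have h3 : IsClosed {P : Matrix (Fin N) (Fin N) ℝ | ∀ j, ∑ i, P i j = 1 / (N : ℝ)} := by
      simp only [ofPred_forall]
      exact isClosed_iInter fun j =>
        isClosed_eq (continuous_finsetSum _ fun i _ => he i j) continuous_const
    exact h1.inter (h2.inter h3)
  · intro P hP i _ j _
    refine ⟨hP.1 i j, ?_⟩
    rw [← hP.2.1 i]
    exact Finset.single_le_sum (f := fun j => P i j) (fun k _ => hP.1 i k) (Finset.mem_univ j)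

theorem couplings_nonempty (N : ℕ) : (couplings N).Nonempty := by
  refine ⟨Matrix.of fun _ _ => 1 / (N : ℝ) * (1 / (N : ℝ)), fun i j => ?_, fun i => ?_,
    fun j => ?_⟩
  · simp only [Matrix.of_apply]; positivity
  · have : (N : ℝ) ≠ 0 := by have := i.pos; positivity
    simp [this]
  · have : (N : ℝ) ≠ 0 := by have := j.pos; positivity
    simp [this]

theorem exists_optimalCoupling {N : ℕ} (ε : ℝ) (C : Matrix (Fin N) (Fin N) ℝ) :
    ∃ P ∈ couplings N, IsMinOn (entropicCost ε C) (couplings N) P :=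
  (isCompact_couplings N).exists_isMinOn (couplings_nonempty N)
    (continuous_entropicCost ε C).continuousOn

/-- The minimizer of the entropic optimal transport problem
(unique for `0 < ε`, by strict convexity). -/
noncomputable def optimalCoupling {N : ℕ} (ε : ℝ) (C : Matrix (Fin N) (Fin N) ℝ) :
    Matrix (Fin N) (Fin N) ℝ :=
  Classical.choose (exists_optimalCoupling ε C)

/-- The collective states `x = [x_1; …; x_N]` of `N` agents in `ℝⁿ`. -/
abbrev State (N n : ℕ) : Type := Fin N → Fin n → ℝ

section Dynamics

variable {N n m : ℕ} (A : Fin N → Matrix (Fin n) (Fin n) ℝ)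
  (B : Fin N → Matrix (Fin n) (Fin m) ℝ) (xd : State N n) (ε T : ℝ)

/-- The transport costs `C_ij(x) = (x_i - xd_j)ᵀ 𝒢_i (x_i - xd_j)`. -/
noncomputable def costMatrix (x : State N n) : Matrix (Fin N) (Fin N) ℝ :=
  Matrix.of fun i j => (x i - xd j) ⬝ᵥ (gramInv (A i) (B i) T *ᵥ (x i - xd j))

/-- The entropic optimal coupling `P*(x)` for the costs `C_ij(x)`. -/
noncomputable def Pstar (x : State N n) : Matrix (Fin N) (Fin N) ℝ :=
  optimalCoupling ε (costMatrix A B xd T x)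

/-- The deviation `x_i - N ∑_j P*_ij(x) xd_j` of agent `i` from its temporary target. -/
noncomputable def deviation (x : State N n) (i : Fin N) : Fin n → ℝ :=
  x i - (N : ℝ) • ∑ j, Pstar A B xd ε T x i j • xd j

/-- The closed-loop vector field `(A_i - B_i B_iᵀ 𝒢_i)(x_i - N ∑_j P*_ij(x) xd_j)`. -/
noncomputable def closedLoopField (x : State N n) : State N n := fun i =>
  (A i - B i * (B i)ᵀ * gramInv (A i) (B i) T) *ᵥ deviation A B xd ε T x i

/-- The vector field `A_i (x_i - N ∑_j P*_ij(x) xd_j)`. -/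
noncomputable def driftField (x : State N n) : State N n := fun i =>
  A i *ᵥ deviation A B xd ε T x i

/-- The set `ℳ'`. -/
def stationarySet : Set (State N n) :=
  {x | ∀ i,
    (B i)ᵀ *ᵥ (gramInv (A i) (B i) T *ᵥ deviation A B xd ε T x i) = 0 ∧
    (B i)ᵀ *ᵥ (NormedSpace.exp (-(T • (A i)ᵀ)) *ᵥ
      (gramInv (A i) (B i) T *ᵥ deviation A B xd ε T x i)) = 0}

end Dynamics

section ODE

variable {E : Type*} [NormedAddCommGroup E] [NormedSpace ℝ E]

/-- `x` solves `ẋ = f(x)` on `[0, ∞)`. -/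
def IsForwardSolution (f : E → E) (x : ℝ → E) : Prop :=
  ∀ t : ℝ, 0 ≤ t → HasDerivWithinAt x (f (x t)) (Ici 0) t

/-- `x` solves `ẋ = f(x)` on the whole real line. -/
def IsGlobalSolution (f : E → E) (x : ℝ → E) : Prop :=
  ∀ t : ℝ, HasDerivAt x (f (x t)) t

/-- `S` is invariant for `ẋ = f(x)`: through each point of `S` there is a solution on the whole
real line, and each such solution stays in `S` for all (positive and negative) times. -/
def IsInvariantSet (f : E → E) (S : Set E) : Prop :=
  ∀ x₀ ∈ S, (∃ x, IsGlobalSolution f x ∧ x 0 = x₀) ∧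
    ∀ x, IsGlobalSolution f x → x 0 = x₀ → ∀ t, x t ∈ S

/-- `x(t)` converges to the set `S` as `t → ∞`: the distance from `x(t)` to `S` tends to `0`
(and `S` is not empty). -/
def ConvergesToSet (x : ℝ → E) (S : Set E) : Prop :=
  ∀ δ : ℝ, 0 < δ → ∃ t₀ : ℝ, ∀ t : ℝ, t₀ ≤ t → ∃ y ∈ S, dist (x t) y < δ

end ODE

end SinkhornMPC

/-! The Lyapunov function is the optimal value `V(x)` of the entropic transport problem. Write `d_i`
for the deviation from the temporary target, `W_i` for the Gramian and `g_i = 𝒢_i d_i`. By the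
envelope theorem (`hasFDerivAt_optimalValue`) the gradient of `V` is `(2/N) g_i` in block `i`: the
minimizer may be frozen when differentiating. Integrating the derivative of the Gramian integrand
gives the Lyapunov equation `A W + W Aᵀ = B Bᵀ - e^{-AT} B Bᵀ e^{-AᵀT}`, and since `d = W g` the
derivative of `V` along the closed loop is `-(1/N) ∑ (|B_iᵀ g_i|² + |B_iᵀ e^{-A_iᵀT} g_i|²)`
(`two_mul_dotProduct_closedLoop`). It is nonpositive and vanishes only on `ℳ'`, where the feedback
term is zero and the closed loop reduces to the drift. Two facts make LaSalle's principle
applicable. Controllability makes `𝒢_i` positive definite, so sublevel sets of `V` are bounded. The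
entropy is strongly convex on couplings, so the optimal coupling is globally Lipschitz in `x`, both
fields are globally Lipschitz, and their flows exist for all times. The ω-limit set of a trajectory
is then invariant for the closed loop and lies in `ℳ'`, hence is invariant for the drift, and it is
contained in the union `L` of all invariant subsets of `ℳ'`. -/

namespace SinkhornMPC

/-! ### Global flows of Lipschitz fields and LaSalle's principle -/

section GlobalODE

open Filter Topology
open scoped NNReal

variable {E : Type*} [NormedAddCommGroup E] [NormedSpace ℝ E] {f g : E → E} {K K' : ℝ≥0}

/-- The radial retraction of a normed space onto the closed ball of radius `R`. -/
noncomputable def radialRetraction (R : ℝ) (x : E) : E := (R / max R ‖x‖) • x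

theorem norm_radialRetraction_le {R : ℝ} (hR : 0 < R) (x : E) : ‖radialRetraction R x‖ ≤ R := by
  have h : 0 < max R ‖x‖ := lt_max_of_lt_left hR
  rw [radialRetraction, norm_smul, Real.norm_of_nonneg (by positivity), div_mul_eq_mul_div,
    div_le_iff₀ h]
  gcongr
  exact le_max_right _ _

theorem norm_radialRetraction_le_norm {R : ℝ} (hR : 0 < R) (x : E) :
    ‖radialRetraction R x‖ ≤ ‖x‖ := by
  have h : 0 < max R ‖x‖ := lt_max_of_lt_left hR
  rw [radialRetraction, norm_smul, Real.norm_of_nonneg (by positivity)]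
  exact mul_le_of_le_one_left (norm_nonneg _) ((div_le_one h).2 (le_max_left _ _))

theorem radialRetraction_of_norm_le {R : ℝ} (hR : 0 < R) {x : E} (hx : ‖x‖ ≤ R) :
    radialRetraction R x = x := by
  rw [radialRetraction, max_eq_left hx, div_self hR.ne', one_smul]

/-- Passing from `x` to `y` at a fixed scale factor, and then changing the factor at `y`, costs at
most `‖x - y‖` each; hence the constant 2. -/
theorem lipschitzWith_radialRetraction {R : ℝ} (hR : 0 < R) :
    LipschitzWith 2 (radialRetraction R : E → E) := by
  refine LipschitzWith.of_dist_le_mul fun x y => ?_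
  have ha : 0 < max R ‖x‖ := lt_max_of_lt_left hR
  have hb : 0 < max R ‖y‖ := lt_max_of_lt_left hR
  have hab : |max R ‖y‖ - max R ‖x‖| ≤ ‖x - y‖ := by
    refine (abs_max_sub_max_le_max _ _ _ _).trans ?_
    rw [sub_self, abs_zero, max_eq_right (abs_nonneg _), norm_sub_rev]
    exact abs_norm_sub_norm_le _ _
  have hsplit : radialRetraction R x - radialRetraction R y =
      (R / max R ‖x‖) • (x - y) + (R / max R ‖x‖ - R / max R ‖y‖) • y := by
    simp only [radialRetraction, smul_sub, sub_smul]; abel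
  rw [dist_eq_norm, dist_eq_norm, hsplit]
  refine (norm_add_le _ _).trans ?_
  have h1 : ‖(R / max R ‖x‖) • (x - y)‖ ≤ ‖x - y‖ := by
    rw [norm_smul, Real.norm_of_nonneg (by positivity)]
    exact mul_le_of_le_one_left (norm_nonneg _) ((div_le_one ha).2 (le_max_left _ _))
  have h2 : ‖(R / max R ‖x‖ - R / max R ‖y‖) • y‖ ≤ ‖x - y‖ := by
    have he : R / max R ‖x‖ - R / max R ‖y‖ =
        (R / max R ‖x‖) * ((max R ‖y‖ - max R ‖x‖) / max R ‖y‖) := by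
      field_simp
    rw [he, norm_smul, norm_mul, Real.norm_of_nonneg (by positivity : 0 ≤ R / max R ‖x‖),
      norm_div, Real.norm_of_nonneg hb.le, Real.norm_eq_abs]
    calc R / max R ‖x‖ * (|max R ‖y‖ - max R ‖x‖| / max R ‖y‖) * ‖y‖
        ≤ 1 * (|max R ‖y‖ - max R ‖x‖| / max R ‖y‖) * max R ‖y‖ := by
          gcongr
          · exact (div_le_one ha).2 (le_max_left _ _)
          · exact le_max_right _ _
      _ = |max R ‖y‖ - max R ‖x‖| := by field_simp
      _ ≤ ‖x - y‖ := hab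
  push_cast
  linarith

/-- Composing `f` with the retraction makes it bounded, so Picard–Lindelöf works on the whole
interval at once. Grönwall's bound, which also holds for `f` itself, keeps the solution inside the
ball where the retraction is the identity. -/
theorem exists_solution_Icc [CompleteSpace E] (hf : LipschitzWith K f) (x₀ : E) {T : ℝ}
    (hT : 0 ≤ T) :
    ∃ x : ℝ → E, x 0 = x₀ ∧ ∀ t ∈ Icc 0 T, HasDerivWithinAt x (f (x t)) (Icc 0 T) t := by
  have hlin : ∀ x, ‖f x‖ ≤ K * ‖x‖ + ‖f 0‖ := fun x => by
    have h := hf.dist_le_mul x 0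
    rw [dist_eq_norm, dist_zero_right] at h
    linarith [norm_le_norm_sub_add (f x) (f 0)]
  set R : ℝ := gronwallBound ‖x₀‖ K ‖f 0‖ T + 1 with hRdef
  have hmono := gronwallBound_mono (norm_nonneg x₀) (norm_nonneg (f 0)) K.coe_nonneg
  have hR : 0 < R := by
    have := hmono hT
    rw [gronwallBound_x0] at this
    have := norm_nonneg x₀
    linarith
  set L : ℝ≥0 := K * R.toNNReal + ‖f 0‖₊ with hL
  have hPL : IsPicardLindelof (fun _ => f ∘ radialRetraction R) (tmin := 0) (tmax := T)
      ⟨0, left_mem_Icc.2 hT⟩ x₀ (L * T.toNNReal) 0 L (K * 2) := by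
    refine IsPicardLindelof.of_time_independent ?_ ?_ ?_
    · intro x _
      refine (hlin _).trans ?_
      simp only [hL, NNReal.coe_add, NNReal.coe_mul, Real.coe_toNNReal _ hR.le, coe_nnnorm]
      gcongr
      exact norm_radialRetraction_le hR x
    · exact (hf.comp (lipschitzWith_radialRetraction hR)).lipschitzOnWith
    · simp [hT]
  obtain ⟨x, hx0, hx⟩ := hPL.exists_eq_forall_mem_Icc_hasDerivWithinAt₀
  have hx' : ∀ t ∈ Ico 0 T, HasDerivWithinAt x (f (radialRetraction R (x t))) (Ici t) t :=
    fun t ht => (hx t ⟨ht.1, ht.2.le⟩).mono_of_mem_nhdsWithin (Icc_mem_nhdsGE_of_mem ht)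
  have hbound := norm_le_gronwallBound_of_norm_deriv_right_le (δ := ‖x₀‖) (K := K) (ε := ‖f 0‖)
    (fun t ht => (hx t ht).continuousWithinAt) hx' (by rw [← hx0])
    (fun t _ => (hlin _).trans (by
      gcongr
      exact norm_radialRetraction_le_norm hR _))
  refine ⟨x, hx0, fun t ht => ?_⟩
  have hle : ‖x t‖ ≤ R := by
    refine (hbound t ht).trans ((hmono (by linarith [ht.2] : t - 0 ≤ T)).trans ?_)
    linarith
  have := hx t ht
  simpa only [Function.comp_apply, radialRetraction_of_norm_le hR hle] using this

theorem eqOn_of_solution_Icc (hf : LipschitzWith K f) {x y : ℝ → E} {T : ℝ}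
    (hx : ∀ t ∈ Icc 0 T, HasDerivWithinAt x (f (x t)) (Icc 0 T) t)
    (hy : ∀ t ∈ Icc 0 T, HasDerivWithinAt y (f (y t)) (Icc 0 T) t) (h0 : x 0 = y 0) :
    EqOn x y (Icc 0 T) :=
  ODE_solution_unique_of_mem_Icc_right (v := fun _ => f) (s := fun _ => univ)
    (fun _ _ => hf.lipschitzOnWith) (fun t ht => (hx t ht).continuousWithinAt)
    (fun t ht => (hx t ⟨ht.1, ht.2.le⟩).mono_of_mem_nhdsWithin (Icc_mem_nhdsGE_of_mem ht))
    (fun _ _ => mem_univ _) (fun t ht => (hy t ht).continuousWithinAt)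
    (fun t ht => (hy t ⟨ht.1, ht.2.le⟩).mono_of_mem_nhdsWithin (Icc_mem_nhdsGE_of_mem ht))
    (fun _ _ => mem_univ _) h0

theorem IsForwardSolution.unique (hf : LipschitzWith K f) {x y : ℝ → E}
    (hx : IsForwardSolution f x) (hy : IsForwardSolution f y) (h0 : x 0 = y 0) {t : ℝ}
    (ht : 0 ≤ t) : x t = y t :=
  eqOn_of_solution_Icc hf (fun s hs => (hx s hs.1).mono Icc_subset_Ici_self)
    (fun s hs => (hy s hs.1).mono Icc_subset_Ici_self) h0 ⟨ht, le_rfl⟩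

/-- The solutions on `[0, n]` agree by uniqueness, so evaluating the one with index `⌈s⌉₊` at `s`
glues them. -/
theorem exists_isForwardSolution [CompleteSpace E] (hf : LipschitzWith K f) (x₀ : E) :
    ∃ x, IsForwardSolution f x ∧ x 0 = x₀ := by
  choose α hα0 hα using fun n : ℕ => exists_solution_Icc hf x₀ (Nat.cast_nonneg (α := ℝ) n)
  have hmono : ∀ {k n : ℕ} {s : ℝ}, k ≤ n → 0 ≤ s → s ≤ k → α k s = α n s := by
    intro k n s hkn h0 hs
    have hsub : Icc (0 : ℝ) k ⊆ Icc 0 n := Icc_subset_Icc_right (by exact_mod_cast hkn)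
    exact eqOn_of_solution_Icc hf (hα k) (fun t ht => (hα n t (hsub ht)).mono hsub)
      ((hα0 k).trans (hα0 n).symm) ⟨h0, hs⟩
  have hceil : ∀ {n : ℕ} {s : ℝ}, 0 ≤ s → s ≤ n → α ⌈s⌉₊ s = α n s := fun h0 hs =>
    hmono (Nat.ceil_le.2 hs) h0 (Nat.le_ceil _)
  refine ⟨fun s => α ⌈s⌉₊ s, fun t ht => ?_, by simpa using hα0 0⟩
  obtain ⟨n, hn⟩ := exists_nat_gt t
  have hnhds : Icc (0 : ℝ) n ∈ 𝓝[Ici 0] t := by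
    rw [← Ici_inter_Iic]
    exact inter_mem_nhdsWithin _ (Iic_mem_nhds hn)
  have hd := (hα n t ⟨ht, hn.le⟩).mono_of_mem_nhdsWithin hnhds
  rw [← hceil ht hn.le] at hd
  refine hd.congr_of_eventuallyEq ?_ (hceil ht hn.le)
  filter_upwards [hnhds] with s hs using hceil hs.1 hs.2

theorem IsGlobalSolution.isForwardSolution {x : ℝ → E} (hx : IsGlobalSolution f x) :
    IsForwardSolution f x := fun t _ => (hx t).hasDerivWithinAt

theorem IsGlobalSolution.comp_neg {x : ℝ → E} (hx : IsGlobalSolution f x) :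
    IsGlobalSolution (fun y => -f y) fun t => x (-t) := fun t => by
  simpa [Function.comp_def] using (hx (-t)).scomp t (hasDerivAt_neg t)

theorem IsGlobalSolution.comp_add_const {x : ℝ → E} (hx : IsGlobalSolution f x) (s : ℝ) :
    IsGlobalSolution f fun t => x (t + s) := fun t => (hx (t + s)).comp_add_const t s

theorem exists_isGlobalSolution [CompleteSpace E] (hf : LipschitzWith K f) (x₀ : E) :
    ∃ x, IsGlobalSolution f x ∧ x 0 = x₀ := by
  obtain ⟨u, hu, hu0⟩ := exists_isForwardSolution hf x₀
  obtain ⟨v, hv, hv0⟩ := exists_isForwardSolution hf.neg x₀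
  have hright : ∀ t : ℝ, 0 ≤ t → (if 0 ≤ t then u t else v (-t)) = u t := fun t ht => if_pos ht
  have hleft : ∀ t : ℝ, t ≤ 0 → (if 0 ≤ t then u t else v (-t)) = v (-t) := fun t ht => by
    rcases ht.eq_or_lt with rfl | h
    · simp [hu0, hv0]
    · exact if_neg h.not_ge
  refine ⟨fun t => if 0 ≤ t then u t else v (-t), fun t => ?_, by simp [hu0]⟩
  have hdr : ∀ t : ℝ, 0 ≤ t → HasDerivWithinAt (fun t => if 0 ≤ t then u t else v (-t))
      (f (if 0 ≤ t then u t else v (-t))) (Ici 0) t := fun t ht => by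
    rw [hright t ht]
    exact (hu t ht).congr (fun s hs => hright s hs) (hright t ht)
  have hdl : ∀ t : ℝ, t ≤ 0 → HasDerivWithinAt (fun t => if 0 ≤ t then u t else v (-t))
      (f (if 0 ≤ t then u t else v (-t))) (Iic 0) t := fun t ht => by
    rw [hleft t ht]
    refine HasDerivWithinAt.congr ?_ (fun s hs => hleft s hs) (hleft t ht)
    have h := (hv (-t) (by linarith)).scomp t (hasDerivAt_neg t).hasDerivWithinAt
      (s := Iic 0) (fun s hs => by simpa using hs)
    simpa [Function.comp_def] using h
  rcases lt_trichotomy t 0 with h | rfl | h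
  · exact (hdl t h.le).hasDerivAt (Iic_mem_nhds h)
  · have := (hdl 0 le_rfl).union (hdr 0 le_rfl)
    rwa [Iic_union_Ici, hasDerivWithinAt_univ] at this
  · exact (hdr t h.le).hasDerivAt (Ici_mem_nhds h)

theorem IsGlobalSolution.dist_le (hf : LipschitzWith K f) {x y : ℝ → E}
    (hx : IsGlobalSolution f x) (hy : IsGlobalSolution f y) (t : ℝ) :
    dist (x t) (y t) ≤ dist (x 0) (y 0) * Real.exp (K * |t|) := by
  have key : ∀ {h : E → E} (_ : LipschitzWith K h) {x y : ℝ → E}, IsGlobalSolution h x →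
      IsGlobalSolution h y → ∀ t : ℝ, 0 ≤ t →
      dist (x t) (y t) ≤ dist (x 0) (y 0) * Real.exp (K * t) := by
    intro h hh x y hx hy t ht
    have := dist_le_of_trajectories_ODE (v := fun _ => h) (a := 0) (b := t) (fun _ => hh)
      (fun s _ => (hx s).continuousAt.continuousWithinAt) (fun s _ => (hx s).hasDerivWithinAt)
      (fun s _ => (hy s).continuousAt.continuousWithinAt) (fun s _ => (hy s).hasDerivWithinAt)
      le_rfl t ⟨ht, le_rfl⟩
    simpa using this
  rcases le_total 0 t with ht | ht
  · rw [abs_of_nonneg ht]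
    exact key hf hx hy t ht
  · rw [abs_of_nonpos ht]
    simpa using key hf.neg hx.comp_neg hy.comp_neg (-t) (by linarith)

theorem IsGlobalSolution.unique (hf : LipschitzWith K f) {x y : ℝ → E}
    (hx : IsGlobalSolution f x) (hy : IsGlobalSolution f y) (h0 : x 0 = y 0) (t : ℝ) :
    x t = y t := by
  have := hx.dist_le hf hy t
  rw [h0, dist_self, zero_mul] at this
  exact dist_le_zero.1 this

/-- The ω-limit set of a trajectory is carried into itself by every solution. -/
theorem IsGlobalSolution.mapClusterPt [CompleteSpace E] (hf : LipschitzWith K f) {x y : ℝ → E}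
    (hx : IsGlobalSolution f x) (hy : IsGlobalSolution f y) (h : MapClusterPt (y 0) atTop x)
    (s : ℝ) : MapClusterPt (y s) atTop x := by
  choose X hX hX0 using fun z => exists_isGlobalSolution hf z
  have hcont : Continuous fun z => X z s := by
    refine (LipschitzWith.of_dist_le_mul (K := (Real.exp (K * |s|)).toNNReal)
      fun z w => ?_).continuous
    have := (hX z).dist_le hf (hX w) s
    rwa [hX0, hX0, mul_comm, ← Real.coe_toNNReal _ (Real.exp_pos _).le] at this
  have hy' : y s = X (y 0) s := hy.unique hf (hX _) (hX0 _).symm s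
  -- The time-`s` flow map sends `x t` to `x (t + s)`. Being continuous, it maps cluster points of
  -- `x` to cluster points of the shifted trajectory.
  have hx' : (fun z => X z s) ∘ x = x ∘ fun t => t + s := by
    funext t
    have := (hX (x t)).unique hf (hx.comp_add_const t) (by simp [hX0]) s
    simpa [add_comm] using this
  have h2 := h.continuousAt_comp (f := fun z => X z s) hcont.continuousAt
  rw [hx', ← hy'] at h2
  exact h2.of_comp (tendsto_atTop_add_const_right _ _ tendsto_id)

/-- **LaSalle's invariance principle** for a Lipschitz field `f` with a proper Lyapunov function
whose derivative along `f` vanishes only on `M`, where `f` agrees with the field `g`. -/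
theorem exists_isInvariantSet_convergesToSet [ProperSpace E] (hf : LipschitzWith K f)
    (hg : LipschitzWith K' g) {V : E → ℝ} {V' : E → E →L[ℝ] ℝ} {M : Set E}
    (hV : ∀ x, HasFDerivAt V (V' x) x) (hle : ∀ x, V' x (f x) ≤ 0)
    (hM : ∀ x, V' x (f x) = 0 → x ∈ M ∧ f x = g x)
    (hbdd : ∀ c, Bornology.IsBounded {x | V x ≤ c}) {x : ℝ → E} (hx : IsGlobalSolution f x) :
    ∃ S, S ⊆ M ∧ IsInvariantSet g S ∧ ConvergesToSet x S := by
  have hVc : Continuous V := continuous_iff_continuousAt.2 fun y => (hV y).continuousAt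
  have hderiv : ∀ {y : ℝ → E}, IsGlobalSolution f y → ∀ t,
      HasDerivAt (fun s => V (y s)) (V' (y t) (f (y t))) t := fun hy t =>
    (hV _).comp_hasDerivAt t (hy t)
  have hanti : Antitone fun t => V (x t) :=
    antitone_of_deriv_nonpos (fun t => (hderiv hx t).differentiableAt)
      fun t => by rw [(hderiv hx t).deriv]; exact hle _
  obtain ⟨Q, hQ, hxQ⟩ : ∃ Q : Set E, IsCompact Q ∧ ∀ t, 0 ≤ t → x t ∈ Q :=
    ⟨closure {y | V y ≤ V (x 0)}, (hbdd _).isCompact_closure,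
      fun t ht => subset_closure (hanti ht)⟩
  obtain ⟨c, hc⟩ : ∃ c, Tendsto (fun t => V (x t)) atTop (𝓝 c) := by
    rcases tendsto_atTop_of_antitone hanti with h | h
    · obtain ⟨b, hb⟩ := hQ.bddBelow_image hVc.continuousOn
      obtain ⟨t, ht, ht0⟩ := ((h.eventually (eventually_lt_atBot b)).and
        (eventually_ge_atTop 0)).exists
      exact absurd (hb ⟨x t, hxQ t ht0, rfl⟩) ht.not_ge
    · exact h
  have hVclus : ∀ {q}, MapClusterPt q atTop x → V q = c := by
    intro q hq
    have h1 : MapClusterPt (V q) atTop (V ∘ x) := hq.continuousAt_comp hVc.continuousAt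
    have h2 : (𝓝 (V q) ⊓ 𝓝 c).NeBot := NeBot.mono h1 (inf_le_inf_left _ hc)
    exact eq_of_nhds_neBot h2
  -- A solution starting in the ω-limit set stays there, where `V` is constantly `c`; its derivative
  -- along `f` therefore vanishes.
  have hflow : ∀ {y : ℝ → E}, IsGlobalSolution f y → MapClusterPt (y 0) atTop x →
      ∀ t, y t ∈ M ∧ f (y t) = g (y t) := by
    intro y hy h0 t
    refine hM _ ?_
    have h1 : (fun s => V (y s)) = fun _ => c :=
      funext fun s => hVclus (hx.mapClusterPt hf hy h0 s)
    have h2 := hderiv hy t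
    rw [h1] at h2
    exact h2.unique (hasDerivAt_const t c)
  refine ⟨{q | MapClusterPt q atTop x}, fun q hq => ?_, fun q hq => ?_, ?_⟩
  · obtain ⟨y, hy, rfl⟩ := exists_isGlobalSolution hf q
    exact (hflow hy hq 0).1
  · obtain ⟨y, hy, rfl⟩ := exists_isGlobalSolution hf q
    have hyg : IsGlobalSolution g y := fun t => by
      rw [← (hflow hy hq t).2]; exact hy t
    refine ⟨⟨y, hyg, rfl⟩, fun z hz hz0 t => ?_⟩
    rw [hz.unique hg hyg hz0 t]
    exact hx.mapClusterPt hf hy hq t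
  · intro δ hδ
    -- Otherwise the trajectory is frequently in the compact part of `Q` at distance at least `δ`
    -- from all its cluster points, and has a cluster point there.
    by_contra! hcon
    have hfreq : ∃ᶠ t in atTop, x t ∈ Q ∩ {p | ∀ q, MapClusterPt q atTop x → δ ≤ dist p q} := by
      refine frequently_atTop.2 fun a => ?_
      obtain ⟨t, ht, hd⟩ := hcon (max a 0)
      exact ⟨t, (le_max_left _ _).trans ht, hxQ t ((le_max_right _ _).trans ht), hd⟩
    have hclosed : IsClosed {p : E | ∀ q, MapClusterPt q atTop x → δ ≤ dist p q} := by
      simp only [ofPred_forall]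
      exact isClosed_iInter fun q => isClosed_iInter fun _ =>
        isClosed_le continuous_const (continuous_id.dist continuous_const)
    obtain ⟨p, hp, hclus⟩ := (hQ.inter_right hclosed).exists_mapClusterPt_of_frequently hfreq
    have := hp.2 p hclus
    rw [dist_self] at this
    linarith

end GlobalODE

/-! ### The Gramian: Lyapunov equation, invertibility, dissipation -/

section Gramian

variable {n m : ℕ} (A : Matrix (Fin n) (Fin n) ℝ) (B : Matrix (Fin n) (Fin m) ℝ) (T : ℝ)

attribute [local instance] Matrix.linftyOpNormedRing Matrix.linftyOpNormedAlgebra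

theorem hasDerivAt_exp_neg_smul (t : ℝ) :
    HasDerivAt (fun t : ℝ => NormedSpace.exp (-(t • A))) (-(A * NormedSpace.exp (-(t • A)))) t := by
  have h := hasDerivAt_exp_smul_const' (𝕂 := ℝ) (-A) t
  simp only [smul_neg, neg_mul] at h
  exact h

theorem hasDerivAt_exp_neg_smul' (t : ℝ) :
    HasDerivAt (fun t : ℝ => NormedSpace.exp (-(t • A))) (-(NormedSpace.exp (-(t • A)) * A)) t := by
  have h := hasDerivAt_exp_smul_const (𝕂 := ℝ) (-A) t
  simp only [smul_neg, mul_neg] at h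
  exact h

theorem hasDerivAt_apply {M : ℝ → Matrix (Fin n) (Fin n) ℝ} {M' : Matrix (Fin n) (Fin n) ℝ} {t : ℝ}
    (ℓ : Matrix (Fin n) (Fin n) ℝ →ₗ[ℝ] ℝ) (h : HasDerivAt M M' t) :
    HasDerivAt (fun t => ℓ (M t)) (ℓ M') t :=
  (LinearMap.toContinuousLinearMap ℓ).hasFDerivAt.comp_hasDerivAt t h

/-- The entry `M a b` as a linear functional of the matrix `M`. -/
def entryFunctional (a b : Fin n) : Matrix (Fin n) (Fin n) ℝ →ₗ[ℝ] ℝ where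
  toFun M := M a b
  map_add' _ _ := rfl
  map_smul' _ _ := rfl

theorem hasDerivAt_entry {M : ℝ → Matrix (Fin n) (Fin n) ℝ} {M' : Matrix (Fin n) (Fin n) ℝ} {t : ℝ}
    (h : HasDerivAt M M' t) (a b : Fin n) : HasDerivAt (fun t => M t a b) (M' a b) t :=
  hasDerivAt_apply (entryFunctional a b) h

/-- The integrand of the Gramian. -/
noncomputable def gramianIntegrand (t : ℝ) : Matrix (Fin n) (Fin n) ℝ :=
  NormedSpace.exp (-(t • A)) * B * Bᵀ * NormedSpace.exp (-(t • Aᵀ))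

/-- `A` is extracted on the left of the first exponential and `Aᵀ` on the right of the second, which
yields the form that integrates to the Lyapunov equation. -/
theorem hasDerivAt_gramianIntegrand (t : ℝ) :
    HasDerivAt (gramianIntegrand A B)
      (-(A * gramianIntegrand A B t) - gramianIntegrand A B t * Aᵀ) t := by
  have h := ((hasDerivAt_exp_neg_smul A t).mul_const (B * Bᵀ)).mul (hasDerivAt_exp_neg_smul' Aᵀ t)
  have hfun : gramianIntegrand A B = (fun t : ℝ => NormedSpace.exp (-(t • A)) * (B * Bᵀ)) *
      fun t : ℝ => NormedSpace.exp (-(t • Aᵀ)) := by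
    funext t
    simp [gramianIntegrand, Matrix.mul_assoc]
  have hval : -(A * gramianIntegrand A B t) - gramianIntegrand A B t * Aᵀ =
      -(A * NormedSpace.exp (-(t • A))) * (B * Bᵀ) * NormedSpace.exp (-(t • Aᵀ)) +
        NormedSpace.exp (-(t • A)) * (B * Bᵀ) * -(NormedSpace.exp (-(t • Aᵀ)) * Aᵀ) := by
    simp only [gramianIntegrand, Matrix.mul_assoc, neg_mul, mul_neg, sub_eq_add_neg]
  rw [hval, hfun]
  exact h

theorem continuous_gramianIntegrand_entry (a b : Fin n) :
    Continuous fun t => gramianIntegrand A B t a b :=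
  continuous_iff_continuousAt.2 fun t =>
    (hasDerivAt_entry (hasDerivAt_gramianIntegrand A B t) a b).continuousAt

theorem gramian_apply (a b : Fin n) :
    gramian A B T a b = ∫ t in (0 : ℝ)..T, gramianIntegrand A B t a b := rfl

theorem transpose_exp_neg_smul (t : ℝ) :
    (NormedSpace.exp (-(t • A)))ᵀ = NormedSpace.exp (-(t • Aᵀ)) := by
  rw [← Matrix.exp_transpose]; simp

theorem gramianIntegrand_eq (t : ℝ) : gramianIntegrand A B t =
    (Bᵀ * NormedSpace.exp (-(t • Aᵀ)))ᵀ * (Bᵀ * NormedSpace.exp (-(t • Aᵀ))) := by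
  rw [Matrix.transpose_mul, transpose_exp_neg_smul, transpose_transpose, transpose_transpose,
    gramianIntegrand]
  simp only [Matrix.mul_assoc]

theorem transpose_gramian : (gramian A B T)ᵀ = gramian A B T := by
  ext a b
  rw [transpose_apply, gramian_apply, gramian_apply]
  congr 1
  funext t
  have h : (gramianIntegrand A B t)ᵀ = gramianIntegrand A B t := by
    rw [gramianIntegrand_eq, Matrix.transpose_mul, transpose_transpose]
  exact congrFun (congrFun h a) b

/-- The Lyapunov equation of the Gramian. -/
theorem mul_gramian_add : A * gramian A B T + gramian A B T * Aᵀ =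
    B * Bᵀ - gramianIntegrand A B T := by
  ext a b
  have hd : ∀ t, HasDerivAt (fun t => gramianIntegrand A B t a b)
      (-(A * gramianIntegrand A B t) a b - (gramianIntegrand A B t * Aᵀ) a b) t := fun t =>
    hasDerivAt_entry (hasDerivAt_gramianIntegrand A B t) a b
  have hc1 : ∀ c, Continuous fun t => A a c * gramianIntegrand A B t c b := fun c =>
    continuous_const.mul (continuous_gramianIntegrand_entry A B c b)
  have hc2 : ∀ c, Continuous fun t => gramianIntegrand A B t a c * Aᵀ c b := fun c =>
    (continuous_gramianIntegrand_entry A B a c).mul continuous_const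
  have hs1 : Continuous fun t => (A * gramianIntegrand A B t) a b := by
    simp only [Matrix.mul_apply]; exact continuous_finsetSum _ fun c _ => hc1 c
  have hs2 : Continuous fun t => (gramianIntegrand A B t * Aᵀ) a b := by
    simp only [Matrix.mul_apply]; exact continuous_finsetSum _ fun c _ => hc2 c
  have hs1' : Continuous fun t => -(A * gramianIntegrand A B t) a b := hs1.neg
  have hFTC := intervalIntegral.integral_eq_sub_of_hasDerivAt (a := 0) (b := T)
    (fun t _ => hd t) ((hs1'.sub hs2).intervalIntegrable _ _)
  have h0 : gramianIntegrand A B 0 = B * Bᵀ := by simp [gramianIntegrand]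
  have e1 : (A * gramian A B T) a b = ∫ t in (0 : ℝ)..T, (A * gramianIntegrand A B t) a b := by
    simp only [Matrix.mul_apply, gramian_apply]
    rw [intervalIntegral.integral_finsetSum fun c _ => (hc1 c).intervalIntegrable _ _]
    simp only [intervalIntegral.integral_const_mul]
  have e2 : (gramian A B T * Aᵀ) a b = ∫ t in (0 : ℝ)..T, (gramianIntegrand A B t * Aᵀ) a b := by
    simp only [Matrix.mul_apply, gramian_apply]
    rw [intervalIntegral.integral_finsetSum fun c _ => (hc2 c).intervalIntegrable _ _]
    simp only [intervalIntegral.integral_mul_const]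
  rw [intervalIntegral.integral_sub (hs1'.intervalIntegrable _ _) (hs2.intervalIntegrable _ _),
    intervalIntegral.integral_neg, ← e1, ← e2, h0] at hFTC
  rw [Matrix.add_apply, Matrix.sub_apply]
  linarith

theorem dotProduct_gramianIntegrand_mulVec (w : Fin n → ℝ) (t : ℝ) :
    w ⬝ᵥ (gramianIntegrand A B t *ᵥ w) =
      (Bᵀ *ᵥ (NormedSpace.exp (-(t • Aᵀ)) *ᵥ w)) ⬝ᵥ
        (Bᵀ *ᵥ (NormedSpace.exp (-(t • Aᵀ)) *ᵥ w)) := by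
  rw [gramianIntegrand_eq, ← mulVec_mulVec, dotProduct_mulVec, vecMul_transpose, mulVec_mulVec]

theorem continuous_dotProduct_gramianIntegrand_mulVec (w : Fin n → ℝ) :
    Continuous fun t => w ⬝ᵥ (gramianIntegrand A B t *ᵥ w) := by
  simp only [dotProduct, mulVec]
  exact continuous_finsetSum _ fun a _ => continuous_const.mul <|
    continuous_finsetSum _ fun b _ =>
      (continuous_gramianIntegrand_entry A B a b).mul continuous_const

theorem dotProduct_gramian_mulVec (w : Fin n → ℝ) :
    w ⬝ᵥ (gramian A B T *ᵥ w) =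
      ∫ t in (0 : ℝ)..T, w ⬝ᵥ (gramianIntegrand A B t *ᵥ w) := by
  have hc : ∀ a b, Continuous fun t => gramianIntegrand A B t a b * w b := fun a b =>
    (continuous_gramianIntegrand_entry A B a b).mul continuous_const
  have hc' : ∀ a, Continuous fun t => w a * ∑ b, gramianIntegrand A B t a b * w b := fun a =>
    continuous_const.mul (continuous_finsetSum _ fun b _ => hc a b)
  simp only [dotProduct, mulVec, gramian_apply]
  rw [intervalIntegral.integral_finsetSum fun a _ => (hc' a).intervalIntegrable _ _]
  refine Finset.sum_congr rfl fun a _ => ?_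
  rw [intervalIntegral.integral_const_mul,
    intervalIntegral.integral_finsetSum fun b _ => (hc a b).intervalIntegrable _ _]
  simp only [intervalIntegral.integral_mul_const]

theorem dotProduct_gramian_mulVec_nonneg (hT : 0 ≤ T) (w : Fin n → ℝ) :
    0 ≤ w ⬝ᵥ (gramian A B T *ᵥ w) := by
  rw [dotProduct_gramian_mulVec]
  refine intervalIntegral.integral_nonneg hT fun t _ => ?_
  rw [dotProduct_gramianIntegrand_mulVec]
  exact Finset.sum_nonneg fun _ _ => mul_self_nonneg _

/-- The functional `M ↦ (Bᵀ M w)_k`. -/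
def observationFunctional (w : Fin n → ℝ) (k : Fin m) : Matrix (Fin n) (Fin n) ℝ →ₗ[ℝ] ℝ where
  toFun M := (Bᵀ *ᵥ (M *ᵥ w)) k
  map_add' M M' := by simp [add_mulVec, mulVec_add]
  map_smul' c M := by simp [smul_mulVec, mulVec_smul]

theorem analyticAt_observation (w : Fin n → ℝ) (k : Fin m) (t : ℝ) :
    AnalyticAt ℝ (fun t : ℝ => (Bᵀ *ᵥ (NormedSpace.exp (-(t • Aᵀ)) *ᵥ w)) k) t := by
  have h1 : AnalyticAt ℝ (fun t : ℝ => -(t • Aᵀ)) t :=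
    (analyticAt_id.smul analyticAt_const).neg
  have h2 : AnalyticAt ℝ (fun t : ℝ => NormedSpace.exp (-(t • Aᵀ))) t :=
    AnalyticAt.comp (f := fun t : ℝ => -(t • Aᵀ)) (NormedSpace.exp_analytic (𝕂 := ℝ) _) h1
  exact ((LinearMap.toContinuousLinearMap (observationFunctional B w k)).analyticAt _).comp h2

variable {A B T}

/-- The quadratic form is the integral of a continuous squared norm, so the observation vanishes on
`[0, T]`. Analyticity extends this to all times, as needed because the steering time in
`IsControllable` is unrelated to `T`. -/
theorem observation_eq_zero (hT : 0 < T) {w : Fin n → ℝ} (hw : w ⬝ᵥ (gramian A B T *ᵥ w) = 0)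
    (t : ℝ) : Bᵀ *ᵥ (NormedSpace.exp (-(t • Aᵀ)) *ᵥ w) = 0 := by
  have hIcc : ∀ s ∈ Icc 0 T, Bᵀ *ᵥ (NormedSpace.exp (-(s • Aᵀ)) *ᵥ w) = 0 := by
    intro s hs
    by_contra hne
    have hpos := intervalIntegral.integral_pos hT
      (continuous_dotProduct_gramianIntegrand_mulVec A B w).continuousOn
      (fun r _ => by
        rw [dotProduct_gramianIntegrand_mulVec]
        exact Finset.sum_nonneg fun _ _ => mul_self_nonneg _)
      ⟨s, hs, by
        rw [dotProduct_gramianIntegrand_mulVec]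
        exact lt_of_le_of_ne (Finset.sum_nonneg fun _ _ => mul_self_nonneg _)
          fun h => hne (dotProduct_self_eq_zero.1 h.symm)⟩
    rw [← dotProduct_gramian_mulVec, hw] at hpos
    exact lt_irrefl _ hpos
  funext k
  have han : AnalyticOnNhd ℝ (fun t : ℝ => (Bᵀ *ᵥ (NormedSpace.exp (-(t • Aᵀ)) *ᵥ w)) k) univ :=
    fun s _ => analyticAt_observation A B w k s
  refine han.eqOn_zero_of_preconnected_of_eventuallyEq_zero isPreconnected_univ
    (mem_univ (T / 2)) ?_ (mem_univ t)
  filter_upwards [Icc_mem_nhds (by linarith : (0 : ℝ) < T / 2) (by linarith : T / 2 < T)]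
    with s hs using congrFun (hIcc s hs) k

/-- The curve `z = e^{-tAᵀ} w` solves the adjoint equation, so `z · x` has derivative `z · B u = 0`
along every controlled trajectory. Steering `w` to `0` gives `w · w = 0`. -/
theorem eq_zero_of_observation_eq_zero (hctrl : IsControllable A B) {w : Fin n → ℝ}
    (hw : ∀ t : ℝ, Bᵀ *ᵥ (NormedSpace.exp (-(t • Aᵀ)) *ᵥ w) = 0) : w = 0 := by
  obtain ⟨S, hS, u, x, -, hx, hx0, hxS⟩ := hctrl w 0
  set z : ℝ → Fin n → ℝ := fun t => NormedSpace.exp (-(t • Aᵀ)) *ᵥ w with hz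
  have hzd : ∀ (t : ℝ) (a : Fin n), HasDerivAt (fun t => z t a) ((-(Aᵀ *ᵥ z t)) a) t := by
    intro t a
    have h := HasDerivAt.fun_sum (u := Finset.univ) fun b (_ : b ∈ Finset.univ) =>
      (hasDerivAt_entry (hasDerivAt_exp_neg_smul Aᵀ t) a b).mul_const (w b)
    have hval : (-(Aᵀ *ᵥ z t)) a = ((-(Aᵀ * NormedSpace.exp (-(t • Aᵀ)))) *ᵥ w) a := by
      simp [hz, neg_mulVec]
    rw [hval]
    exact h
  have hxd : ∀ t ∈ Icc 0 S, ∀ a,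
      HasDerivWithinAt (fun t => x t a) ((A *ᵥ x t + B *ᵥ u t) a) (Icc 0 S) t := fun t ht a =>
    hasDerivWithinAt_pi.1 (hx t ht) a
  have hψ : ∀ t ∈ Icc 0 S, HasDerivWithinAt (fun t => z t ⬝ᵥ x t) 0 (Icc 0 S) t := by
    intro t ht
    have h := HasDerivWithinAt.fun_sum (u := Finset.univ) fun a (_ : a ∈ Finset.univ) =>
      (hzd t a).hasDerivWithinAt.mul (hxd t ht a)
    have hval : ∑ a, ((-(Aᵀ *ᵥ z t)) a * x t a + z t a * (A *ᵥ x t + B *ᵥ u t) a) =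
        -(Aᵀ *ᵥ z t) ⬝ᵥ x t + z t ⬝ᵥ (A *ᵥ x t + B *ᵥ u t) := Finset.sum_add_distrib
    have h1 : z t ⬝ᵥ (A *ᵥ x t) = (Aᵀ *ᵥ z t) ⬝ᵥ x t := by
      rw [dotProduct_mulVec, mulVec_transpose]
    have h2 : z t ⬝ᵥ (B *ᵥ u t) = 0 := by
      rw [dotProduct_mulVec, ← mulVec_transpose, hw t, zero_dotProduct]
    rw [hval, neg_dotProduct, dotProduct_add, h1, h2, add_zero, neg_add_cancel] at h
    exact h
  have hconst := constant_of_has_deriv_right_zero (fun t ht => (hψ t ht).continuousWithinAt)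
    (fun t ht => (hψ t ⟨ht.1, ht.2.le⟩).mono_of_mem_nhdsWithin (Icc_mem_nhdsGE_of_mem ht))
    S ⟨hS.le, le_rfl⟩
  simp only [hxS, hx0, dotProduct_zero, hz, zero_smul, neg_zero, NormedSpace.exp_zero,
    one_mulVec] at hconst
  exact dotProduct_self_eq_zero.1 hconst.symm

theorem isUnit_det_gramian (hT : 0 < T) (hctrl : IsControllable A B) :
    IsUnit (gramian A B T).det := by
  rw [isUnit_iff_ne_zero]
  intro h
  obtain ⟨w, hw, hw0⟩ := Matrix.exists_mulVec_eq_zero_iff.2 h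
  exact hw (eq_zero_of_observation_eq_zero hctrl
    (observation_eq_zero hT (by rw [hw0, dotProduct_zero])))

variable (A B T) in
theorem transpose_gramInv : (gramInv A B T)ᵀ = gramInv A B T := by
  rw [gramInv, transpose_nonsing_inv, transpose_gramian]

theorem gramian_mulVec_gramInv_mulVec (hT : 0 < T) (hctrl : IsControllable A B) (v : Fin n → ℝ) :
    gramian A B T *ᵥ (gramInv A B T *ᵥ v) = v := by
  rw [mulVec_mulVec, gramInv, mul_nonsing_inv _ (isUnit_det_gramian hT hctrl), one_mulVec]

theorem dotProduct_gramInv_mulVec_nonneg (hT : 0 < T) (hctrl : IsControllable A B)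
    (v : Fin n → ℝ) : 0 ≤ v ⬝ᵥ (gramInv A B T *ᵥ v) := by
  have h := dotProduct_gramian_mulVec_nonneg A B T hT.le (gramInv A B T *ᵥ v)
  rwa [gramian_mulVec_gramInv_mulVec hT hctrl, dotProduct_comm] at h

/-- Coercivity of the inverse Gramian, one coordinate at a time. -/
theorem sq_le_gramian_mul_dotProduct (hT : 0 < T) (hctrl : IsControllable A B) (v : Fin n → ℝ)
    (a : Fin n) : v a ^ 2 ≤ gramian A B T a a * (v ⬝ᵥ (gramInv A B T *ᵥ v)) := by
  set G := gramInv A B T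
  set W := gramian A B T with hW
  have hWG : W *ᵥ (G *ᵥ v) = v := gramian_mulVec_gramInv_mulVec hT hctrl v
  have hsymm : (G *ᵥ v) ⬝ᵥ (W *ᵥ Pi.single a 1) = v a := by
    rw [dotProduct_mulVec, ← mulVec_transpose, transpose_gramian, hWG, dotProduct_single, mul_one]
  -- Cauchy–Schwarz by discriminant: the form of `W` is evaluated at `t e_a - 𝒢 v`.
  have hquad : ∀ t : ℝ, 0 ≤ W a a * (t * t) + (-2 * v a) * t + v ⬝ᵥ (G *ᵥ v) := by
    intro t
    have h := dotProduct_gramian_mulVec_nonneg A B T hT.le (t • Pi.single a 1 - G *ᵥ v)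
    rw [← hW, mulVec_sub, mulVec_smul, hWG, sub_dotProduct, dotProduct_sub, dotProduct_sub,
      dotProduct_smul, dotProduct_smul, smul_dotProduct, smul_dotProduct, hsymm,
      single_one_dotProduct, single_one_dotProduct, mulVec_single_one, dotProduct_comm (G *ᵥ v)] at h
    simp only [smul_eq_mul, Matrix.col_apply] at h
    linarith
  have hd := discrim_le_zero hquad
  rw [discrim] at hd
  nlinarith

/-- The dissipation identity for the feedback `-Bᵀ 𝒢`. -/
theorem two_mul_dotProduct_closedLoop (hT : 0 < T) (hctrl : IsControllable A B) (d : Fin n → ℝ) :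
    2 * ((gramInv A B T *ᵥ d) ⬝ᵥ ((A - B * Bᵀ * gramInv A B T) *ᵥ d)) =
      -((Bᵀ *ᵥ (gramInv A B T *ᵥ d)) ⬝ᵥ (Bᵀ *ᵥ (gramInv A B T *ᵥ d)) +
        (Bᵀ *ᵥ (NormedSpace.exp (-(T • Aᵀ)) *ᵥ (gramInv A B T *ᵥ d))) ⬝ᵥ
          (Bᵀ *ᵥ (NormedSpace.exp (-(T • Aᵀ)) *ᵥ (gramInv A B T *ᵥ d)))) := by
  set G := gramInv A B T
  set W := gramian A B T with hW
  set g := G *ᵥ d with hg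
  have hWg : W *ᵥ g = d := gramian_mulVec_gramInv_mulVec hT hctrl d
  have h1 : g ⬝ᵥ (A *ᵥ d) = g ⬝ᵥ ((A * W) *ᵥ g) := by rw [← mulVec_mulVec, hWg]
  have h2 : g ⬝ᵥ ((W * Aᵀ) *ᵥ g) = g ⬝ᵥ ((A * W) *ᵥ g) := by
    rw [dotProduct_mulVec, ← mulVec_transpose, transpose_mul, transpose_transpose,
      transpose_gramian, dotProduct_comm]
  have h3 : g ⬝ᵥ ((B * Bᵀ) *ᵥ g) = (Bᵀ *ᵥ g) ⬝ᵥ (Bᵀ *ᵥ g) := by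
    rw [← mulVec_mulVec, dotProduct_mulVec, ← mulVec_transpose]
  -- As `d = W g`, `2 g · A d` is the form of `A W + W Aᵀ` at `g`. The Lyapunov equation contributes
  -- `+|Bᵀ g|²` to it, and the feedback contributes `-2 |Bᵀ g|²`.
  have h4 := congrArg (fun M => g ⬝ᵥ (M *ᵥ g)) (mul_gramian_add A B T)
  simp only [add_mulVec, sub_mulVec, dotProduct_add, dotProduct_sub, h3,
    dotProduct_gramianIntegrand_mulVec] at h4
  rw [sub_mulVec, dotProduct_sub, ← mulVec_mulVec (M := B * Bᵀ), ← hg, h3, h1]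
  linarith

end Gramian

/-! ### Strong convexity of the entropic cost -/

section StrongConvexity

variable {N : ℕ}

theorem convexOn_mul_log_sub_sq :
    ConvexOn ℝ (Icc 0 1) fun p : ℝ => p * (Real.log p - 1) - p ^ 2 / 2 := by
  have hd : ∀ p : ℝ, 0 < p →
      HasDerivAt (fun p : ℝ => p * (Real.log p - 1) - p ^ 2 / 2) (Real.log p - p) p := by
    intro p hp
    have h := ((hasDerivAt_id' p).mul ((Real.hasDerivAt_log hp.ne').sub_const 1)).sub
      ((hasDerivAt_pow 2 p).div_const 2)
    convert! h using 1
    field_simp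
    ring
  refine MonotoneOn.convexOn_of_deriv (convex_Icc 0 1) ?_ ?_ ?_
  · have : (fun p : ℝ => p * (Real.log p - 1) - p ^ 2 / 2) =
        fun p => p * Real.log p - p - p ^ 2 / 2 := by funext p; ring
    rw [this]
    exact ((Real.continuous_mul_log.sub continuous_id).sub
      ((continuous_pow 2).div_const 2)).continuousOn
  · rw [interior_Icc]
    exact fun p hp => (hd p hp.1).differentiableAt.differentiableWithinAt
  · rw [interior_Icc]
    intro p hp q hq hpq
    rw [(hd p hp.1).deriv, (hd q hq.1).deriv]
    -- Monotonicity of `log p - p` on `(0, 1)`: `log q - log p ≥ 1 - p/q ≥ q - p`.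
    have h := Real.one_sub_inv_le_log_of_pos (div_pos hq.1 hp.1)
    rw [Real.log_div hq.1.ne' hp.1.ne', inv_div] at h
    have h2 : q - p ≤ 1 - p / q := by
      rw [one_sub_div hq.1.ne', le_div_iff₀ hq.1]
      exact mul_le_of_le_one_right (by linarith) hq.2.le
    linarith

theorem mul_log_midpoint_le {p q : ℝ} (hp : p ∈ Icc (0 : ℝ) 1) (hq : q ∈ Icc (0 : ℝ) 1) :
    ((p + q) / 2) * (Real.log ((p + q) / 2) - 1) ≤
      (p * (Real.log p - 1) + q * (Real.log q - 1)) / 2 - (p - q) ^ 2 / 8 := by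
  obtain ⟨-, hconv⟩ := convexOn_mul_log_sub_sq
  have h := hconv hp hq (by norm_num : (0 : ℝ) ≤ 1 / 2) (by norm_num : (0 : ℝ) ≤ 1 / 2)
    (by norm_num)
  simp only [smul_eq_mul] at h
  rw [show 1 / 2 * p + 1 / 2 * q = (p + q) / 2 by ring] at h
  linarith

theorem neg_one_le_mul_log {p : ℝ} (hp : 0 ≤ p) : -1 ≤ p * (Real.log p - 1) := by
  rcases hp.eq_or_lt with rfl | h
  · simp
  · have h1 := mul_le_mul_of_nonneg_left (Real.one_sub_inv_le_log_of_pos h) hp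
    rw [mul_sub, mul_inv_cancel₀ h.ne'] at h1
    linarith

theorem mem_Icc_of_mem_couplings {P : Matrix (Fin N) (Fin N) ℝ} (hP : P ∈ couplings N)
    (i j : Fin N) : P i j ∈ Icc (0 : ℝ) 1 := by
  refine ⟨hP.1 i j, (Finset.single_le_sum (fun k _ => hP.1 i k) (Finset.mem_univ j)).trans ?_⟩
  rw [hP.2.1 i]
  have : (1 : ℝ) ≤ N := by exact_mod_cast i.pos
  exact (div_le_one (by linarith)).2 this

theorem optimalCoupling_mem (ε : ℝ) (C : Matrix (Fin N) (Fin N) ℝ) :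
    optimalCoupling ε C ∈ couplings N :=
  (Classical.choose_spec (exists_optimalCoupling ε C)).1

theorem entropicCost_optimalCoupling_le (ε : ℝ) (C : Matrix (Fin N) (Fin N) ℝ)
    {Q : Matrix (Fin N) (Fin N) ℝ} (hQ : Q ∈ couplings N) :
    entropicCost ε C (optimalCoupling ε C) ≤ entropicCost ε C Q :=
  (Classical.choose_spec (exists_optimalCoupling ε C)).2 hQ

theorem entropicCost_eq (ε : ℝ) (C P : Matrix (Fin N) (Fin N) ℝ) :
    entropicCost ε C P = ∑ i, ∑ j, (C i j * P i j + ε * (P i j * (Real.log (P i j) - 1))) := by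
  simp only [entropicCost, entropy, Finset.sum_add_distrib, Finset.mul_sum, mul_neg, sub_neg_eq_add]

theorem midpoint_mem_couplings {P Q : Matrix (Fin N) (Fin N) ℝ} (hP : P ∈ couplings N)
    (hQ : Q ∈ couplings N) : (Matrix.of fun i j => (P i j + Q i j) / 2) ∈ couplings N := by
  refine ⟨fun i j => ?_, fun i => ?_, fun j => ?_⟩
  · have := hP.1 i j
    have := hQ.1 i j
    simp only [of_apply]
    positivity
  · simp only [of_apply, ← Finset.sum_div, Finset.sum_add_distrib, hP.2.1 i, hQ.2.1 i]
    ring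
  · simp only [of_apply, ← Finset.sum_div, Finset.sum_add_distrib, hP.2.2 j, hQ.2.2 j]
    ring

/-- Quadratic growth of the entropic cost away from its minimizer. -/
theorem entropicCost_optimalCoupling_add_le {ε : ℝ} (hε : 0 < ε) (C : Matrix (Fin N) (Fin N) ℝ)
    {Q : Matrix (Fin N) (Fin N) ℝ} (hQ : Q ∈ couplings N) :
    entropicCost ε C (optimalCoupling ε C) +
      ε / 4 * ∑ i, ∑ j, (optimalCoupling ε C i j - Q i j) ^ 2 ≤ entropicCost ε C Q := by
  set P := optimalCoupling ε C with hPdef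
  have hP : P ∈ couplings N := optimalCoupling_mem ε C
  -- The midpoint of `P` and `Q` costs no less than `P`, while strong convexity puts it `ε/8 ∑ (P -
  -- Q)²` below the average; doubling gives `ε/4`.
  have h1 := entropicCost_optimalCoupling_le ε C (midpoint_mem_couplings hP hQ)
  have h2 : entropicCost ε C (Matrix.of fun i j => (P i j + Q i j) / 2) ≤
      (entropicCost ε C P + entropicCost ε C Q) / 2 -
        ε / 8 * ∑ i, ∑ j, (P i j - Q i j) ^ 2 := by
    simp only [entropicCost_eq, of_apply, Finset.mul_sum]
    rw [← Finset.sum_add_distrib, Finset.sum_div, ← Finset.sum_sub_distrib]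
    refine Finset.sum_le_sum fun i _ => ?_
    rw [← Finset.sum_add_distrib, Finset.sum_div, ← Finset.sum_sub_distrib]
    refine Finset.sum_le_sum fun j _ => ?_
    have h := mul_le_mul_of_nonneg_left (mul_log_midpoint_le (mem_Icc_of_mem_couplings hP i j)
      (mem_Icc_of_mem_couplings hQ i j)) hε.le
    linarith
  rw [← hPdef] at h1
  linarith

theorem entropicCost_sub (ε : ℝ) (C C' P : Matrix (Fin N) (Fin N) ℝ) :
    entropicCost ε C P - entropicCost ε C' P = ∑ i, ∑ j, (C i j - C' i j) * P i j := by
  simp only [entropicCost, sub_mul, Finset.sum_sub_distrib]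
  ring

/-- The optimal coupling depends monotonically on the cost. -/
theorem mul_sum_sq_sub_optimalCoupling_le {ε : ℝ} (hε : 0 < ε) (C C' : Matrix (Fin N) (Fin N) ℝ) :
    ε / 2 * ∑ i, ∑ j, (optimalCoupling ε C i j - optimalCoupling ε C' i j) ^ 2 ≤
      -∑ i, ∑ j, (C i j - C' i j) * (optimalCoupling ε C i j - optimalCoupling ε C' i j) := by
  -- Each minimizer is tested against the other; in the sum of the two inequalities the entropies
  -- cancel.
  have h1 := entropicCost_optimalCoupling_add_le hε C (optimalCoupling_mem ε C')
  have h2 := entropicCost_optimalCoupling_add_le hε C' (optimalCoupling_mem ε C)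
  have h3 : ∑ i, ∑ j, (optimalCoupling ε C' i j - optimalCoupling ε C i j) ^ 2 =
      ∑ i, ∑ j, (optimalCoupling ε C i j - optimalCoupling ε C' i j) ^ 2 :=
    Finset.sum_congr rfl fun i _ => Finset.sum_congr rfl fun j _ => by ring
  rw [h3] at h2
  have h4 := entropicCost_sub ε C C' (optimalCoupling ε C)
  have h5 := entropicCost_sub ε C C' (optimalCoupling ε C')
  simp only [mul_sub, Finset.sum_sub_distrib] at h4 h5 ⊢
  linarith

end StrongConvexity

/-! ### Lipschitz dependence of the optimal coupling on the state -/

section Lipschitz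

variable {N n m : ℕ} (A : Fin N → Matrix (Fin n) (Fin n) ℝ)
  (B : Fin N → Matrix (Fin n) (Fin m) ℝ) (xd : State N n) {ε : ℝ} (T : ℝ)

theorem abs_dotProduct_le (v w : Fin n → ℝ) : |v ⬝ᵥ w| ≤ ‖v‖ * ∑ a, |w a| := by
  rw [dotProduct, Finset.mul_sum]
  refine (Finset.abs_sum_le_sum_abs _ _).trans (Finset.sum_le_sum fun a _ => ?_)
  rw [abs_mul]
  gcongr
  exact norm_le_pi_norm v a

theorem dotProduct_gramInv_mulVec_comm (M : Matrix (Fin n) (Fin n) ℝ) (L : Matrix (Fin n) (Fin m) ℝ)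
    (v w : Fin n → ℝ) : v ⬝ᵥ (gramInv M L T *ᵥ w) = w ⬝ᵥ (gramInv M L T *ᵥ v) := by
  rw [dotProduct_mulVec, ← mulVec_transpose, transpose_gramInv, dotProduct_comm]

theorem costMatrix_sub (x y : State N n) (i j : Fin N) :
    costMatrix A B xd T x i j - costMatrix A B xd T y i j =
      2 * ((x i - y i) ⬝ᵥ (gramInv (A i) (B i) T *ᵥ (y i - xd j))) +
        (x i - y i) ⬝ᵥ (gramInv (A i) (B i) T *ᵥ (x i - y i)) := by
  have hx : x i - xd j = (x i - y i) + (y i - xd j) := by abel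
  simp only [costMatrix, of_apply]
  rw [hx, mulVec_add, dotProduct_add, add_dotProduct, add_dotProduct,
    dotProduct_gramInv_mulVec_comm T (A i) (B i) (y i - xd j) (x i - y i)]
  ring

/-- Each row of `P` has mass `1/N`, so averaging the first-order terms over `j` replaces the targets
by their barycenter. At the optimal `P` this produces the deviation as gradient. -/
theorem sum_costMatrix_sub_mul {P : Matrix (Fin N) (Fin N) ℝ} (hP : P ∈ couplings N)
    (x y : State N n) :
    ∑ i, ∑ j, (costMatrix A B xd T x i j - costMatrix A B xd T y i j) * P i j =
      1 / (N : ℝ) * ∑ i, (2 * ((x i - y i) ⬝ᵥ (gramInv (A i) (B i) T *ᵥ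
        (y i - (N : ℝ) • ∑ j, P i j • xd j))) +
        (x i - y i) ⬝ᵥ (gramInv (A i) (B i) T *ᵥ (x i - y i))) := by
  rw [Finset.mul_sum]
  refine Finset.sum_congr rfl fun i _ => ?_
  have hN : (N : ℝ) ≠ 0 := by have := i.pos; positivity
  have h1 : ∀ j, (costMatrix A B xd T x i j - costMatrix A B xd T y i j) * P i j =
      P i j * (2 * ((x i - y i) ⬝ᵥ (gramInv (A i) (B i) T *ᵥ y i)) +
        (x i - y i) ⬝ᵥ (gramInv (A i) (B i) T *ᵥ (x i - y i))) -
      2 * (P i j * ((x i - y i) ⬝ᵥ (gramInv (A i) (B i) T *ᵥ xd j))) := fun j => by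
    rw [costMatrix_sub, mulVec_sub _ (y i), dotProduct_sub]
    ring
  have h2 : (x i - y i) ⬝ᵥ (gramInv (A i) (B i) T *ᵥ ∑ j, P i j • xd j) =
      ∑ j, P i j * ((x i - y i) ⬝ᵥ (gramInv (A i) (B i) T *ᵥ xd j)) := by
    rw [mulVec_sum, dotProduct_sum]
    exact Finset.sum_congr rfl fun j _ => by rw [mulVec_smul, dotProduct_smul, smul_eq_mul]
  simp only [h1]
  rw [Finset.sum_sub_distrib, ← Finset.sum_mul, ← Finset.mul_sum, hP.2.1 i, ← h2,
    mulVec_sub _ (y i), mulVec_smul, dotProduct_sub, dotProduct_smul, smul_eq_mul]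
  field_simp
  ring

/-- The terms quadratic in the states do not depend on `j` and are killed by the zero row sums of `P
- Q`. What remains is linear in `x - y`, so the constant is uniform although the cost is quadratic.
-/
theorem exists_abs_sum_costMatrix_sub_mul_le : ∃ κ : ℝ, 0 ≤ κ ∧ ∀ (x y : State N n),
    ∀ P ∈ couplings N, ∀ Q ∈ couplings N,
    |∑ i, ∑ j, (costMatrix A B xd T x i j - costMatrix A B xd T y i j) * (P i j - Q i j)| ≤
      κ * ‖x - y‖ * ∑ i, ∑ j, |P i j - Q i j| := by
  set κ : ℝ := ∑ i, ∑ j, ∑ a, |(gramInv (A i) (B i) T *ᵥ xd j) a| with hκ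
  have hκ0 : 0 ≤ κ := Finset.sum_nonneg fun _ _ => Finset.sum_nonneg fun _ _ =>
    Finset.sum_nonneg fun _ _ => abs_nonneg _
  refine ⟨2 * κ, by positivity, fun x y P hP Q hQ => ?_⟩
  have h1 : ∑ i, ∑ j, (costMatrix A B xd T x i j - costMatrix A B xd T y i j) * (P i j - Q i j) =
      ∑ i, ∑ j, -2 * ((x i - y i) ⬝ᵥ (gramInv (A i) (B i) T *ᵥ xd j)) * (P i j - Q i j) := by
    refine Finset.sum_congr rfl fun i _ => ?_
    have h0 : ∑ j, (P i j - Q i j) = 0 := by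
      rw [Finset.sum_sub_distrib, hP.2.1 i, hQ.2.1 i, sub_self]
    rw [← sub_eq_zero, ← Finset.sum_sub_distrib]
    refine Eq.trans ?_ (mul_eq_zero_of_right
      (2 * ((x i - y i) ⬝ᵥ (gramInv (A i) (B i) T *ᵥ y i)) +
        (x i - y i) ⬝ᵥ (gramInv (A i) (B i) T *ᵥ (x i - y i))) h0)
    rw [Finset.mul_sum]
    refine Finset.sum_congr rfl fun j _ => ?_
    rw [costMatrix_sub, mulVec_sub _ (y i), dotProduct_sub]
    ring
  rw [h1, Finset.mul_sum]
  refine (Finset.abs_sum_le_sum_abs _ _).trans (Finset.sum_le_sum fun i _ => ?_)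
  rw [Finset.mul_sum]
  refine (Finset.abs_sum_le_sum_abs _ _).trans (Finset.sum_le_sum fun j _ => ?_)
  rw [abs_mul, abs_mul, abs_neg, abs_two]
  refine mul_le_mul_of_nonneg_right ?_ (abs_nonneg _)
  have hle : ∑ a, |(gramInv (A i) (B i) T *ᵥ xd j) a| ≤ κ :=
    (Finset.single_le_sum (f := fun j => ∑ a, |(gramInv (A i) (B i) T *ᵥ xd j) a|)
      (fun _ _ => Finset.sum_nonneg fun _ _ => abs_nonneg _) (Finset.mem_univ j)).trans
    (Finset.single_le_sum (f := fun i => ∑ j, ∑ a, |(gramInv (A i) (B i) T *ᵥ xd j) a|)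
      (fun _ _ => Finset.sum_nonneg fun _ _ => Finset.sum_nonneg fun _ _ => abs_nonneg _)
      (Finset.mem_univ i))
  have h2 : |(x i - y i) ⬝ᵥ (gramInv (A i) (B i) T *ᵥ xd j)| ≤ ‖x - y‖ * κ :=
    (abs_dotProduct_le _ _).trans (mul_le_mul (norm_le_pi_norm (x - y) i) hle
      (Finset.sum_nonneg fun _ _ => abs_nonneg _) (norm_nonneg _))
  linarith

variable (ε) in
theorem Pstar_mem (x : State N n) : Pstar A B xd ε T x ∈ couplings N := optimalCoupling_mem _ _

/-- Strong monotonicity and Cauchy–Schwarz over the `N²` entries bound `s²` by a multiple of `‖x -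
y‖ s`; one factor `s` is then cancelled. -/
theorem exists_sum_abs_Pstar_sub_le (hε : 0 < ε) : ∃ κ : ℝ, 0 ≤ κ ∧ ∀ x y : State N n,
    ∑ i, ∑ j, |Pstar A B xd ε T x i j - Pstar A B xd ε T y i j| ≤ κ * ‖x - y‖ := by
  obtain ⟨κ, hκ0, hκ⟩ := exists_abs_sum_costMatrix_sub_mul_le A B xd T
  refine ⟨(N * N : ℝ) * (2 / ε * κ), by positivity, fun x y => ?_⟩
  set s := ∑ i, ∑ j, |Pstar A B xd ε T x i j - Pstar A B xd ε T y i j| with hs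
  have hs0 : 0 ≤ s := Finset.sum_nonneg fun _ _ => Finset.sum_nonneg fun _ _ => abs_nonneg _
  have h1 := mul_sum_sq_sub_optimalCoupling_le hε (costMatrix A B xd T x) (costMatrix A B xd T y)
  have h2 := (neg_le_abs _).trans 
    (hκ x y _ (Pstar_mem A B xd ε T x) _ (Pstar_mem A B xd ε T y))
  have h3 : s ^ 2 ≤ (N * N : ℝ) *
      ∑ i, ∑ j, (Pstar A B xd ε T x i j - Pstar A B xd ε T y i j) ^ 2 := by
    have h := sq_sum_le_card_mul_sum_sq (s := (Finset.univ : Finset (Fin N × Fin N)))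
      (f := fun p => |Pstar A B xd ε T x p.1 p.2 - Pstar A B xd ε T y p.1 p.2|)
    simpa [Fintype.sum_prod_type, sq_abs] using h
  have h4 : s ^ 2 ≤ (N * N : ℝ) * (2 / ε * κ) * ‖x - y‖ * s := by
    have h5 := h1.trans h2
    have h6 : ∑ i, ∑ j, (Pstar A B xd ε T x i j - Pstar A B xd ε T y i j) ^ 2 ≤
        2 / ε * (κ * ‖x - y‖ * s) := by
      rw [div_mul_eq_mul_div, le_div_iff₀ hε]
      simp only [← Pstar.eq_1] at h5
      linarith
    calc s ^ 2 ≤ _ := h3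
      _ ≤ (N * N : ℝ) * (2 / ε * (κ * ‖x - y‖ * s)) := by gcongr
      _ = _ := by ring
  rcases hs0.eq_or_lt with h | h
  · rw [← h]; positivity
  · rw [sq] at h4
    exact le_of_mul_le_mul_right h4 h

theorem exists_lipschitzWith_deviation (hε : 0 < ε) :
    ∃ K, LipschitzWith K (deviation A B xd ε T) := by
  obtain ⟨κ, hκ0, hκ⟩ := exists_sum_abs_Pstar_sub_le A B xd T hε
  refine ⟨(1 + N * (κ * ‖xd‖)).toNNReal, LipschitzWith.of_dist_le_mul fun x y => ?_⟩
  rw [Real.coe_toNNReal _ (by positivity), dist_eq_norm, dist_eq_norm]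
  refine (pi_norm_le_iff_of_nonneg (by positivity)).2 fun i => ?_
  have h1 : (deviation A B xd ε T x - deviation A B xd ε T y) i = (x i - y i) -
      (N : ℝ) • ∑ j, (Pstar A B xd ε T x i j - Pstar A B xd ε T y i j) • xd j := by
    simp only [Pi.sub_apply, deviation, sub_smul, Finset.sum_sub_distrib, smul_sub]
    abel
  have h2 : ‖∑ j, (Pstar A B xd ε T x i j - Pstar A B xd ε T y i j) • xd j‖ ≤
      κ * ‖x - y‖ * ‖xd‖ := by
    refine (norm_sum_le _ _).trans ?_
    refine le_trans ?_ (mul_le_mul_of_nonneg_right (hκ x y) (norm_nonneg _))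
    refine le_trans ?_ (mul_le_mul_of_nonneg_right (Finset.single_le_sum
      (f := fun i => ∑ j, |Pstar A B xd ε T x i j - Pstar A B xd ε T y i j|)
      (fun _ _ => Finset.sum_nonneg fun _ _ => abs_nonneg _) (Finset.mem_univ i)) (norm_nonneg _))
    rw [Finset.sum_mul]
    refine Finset.sum_le_sum fun j _ => ?_
    rw [norm_smul, Real.norm_eq_abs]
    gcongr
    exact norm_le_pi_norm xd j
  rw [h1]
  refine (norm_sub_le _ _).trans ?_
  rw [norm_smul, Real.norm_of_nonneg (Nat.cast_nonneg N)]
  have h3 := norm_le_pi_norm (x - y) i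
  have h4 := mul_le_mul_of_nonneg_left h2 (Nat.cast_nonneg (α := ℝ) N)
  simp only [Pi.sub_apply] at h3
  linarith

theorem exists_lipschitzWith_mulVec_deviation (hε : 0 < ε) (M : Fin N → Matrix (Fin n) (Fin n) ℝ) :
    ∃ K, LipschitzWith K fun (x : State N n) i => M i *ᵥ deviation A B xd ε T x i := by
  obtain ⟨K, hK⟩ := exists_lipschitzWith_deviation A B xd T hε
  let Λ : State N n →ₗ[ℝ] State N n :=
    { toFun := fun v i => M i *ᵥ v i
      map_add' := fun v w => by funext i; simp [mulVec_add]
      map_smul' := fun c v => by funext i; simp [mulVec_smul] }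
  exact ⟨_, (LinearMap.toContinuousLinearMap Λ).lipschitz.comp hK⟩

end Lipschitz

/-! ### The optimal value as a proper Lyapunov function -/

section Lyapunov

open Topology

variable {N n m : ℕ} (A : Fin N → Matrix (Fin n) (Fin n) ℝ)
  (B : Fin N → Matrix (Fin n) (Fin m) ℝ) (xd : State N n) (ε T : ℝ)

/-- The optimal value of the entropic transport problem, a Lyapunov function of the closed loop. -/
noncomputable def optimalValue (x : State N n) : ℝ :=
  entropicCost ε (costMatrix A B xd T x) (Pstar A B xd ε T x)

/-- The derivative of the optimal value. -/
noncomputable def optimalValueDeriv (x : State N n) : State N n →L[ℝ] ℝ :=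
  LinearMap.toContinuousLinearMap
    { toFun := fun h => 1 / (N : ℝ) *
        ∑ i, 2 * (h i ⬝ᵥ (gramInv (A i) (B i) T *ᵥ deviation A B xd ε T x i))
      map_add' := fun h k => by
        simp [add_dotProduct, mul_add, Finset.sum_add_distrib]
      map_smul' := fun c h => by
        simp only [Pi.smul_apply, smul_dotProduct, smul_eq_mul, RingHom.id_apply, Finset.mul_sum]
        exact Finset.sum_congr rfl fun i _ => by ring }

theorem optimalValueDeriv_apply (x h : State N n) : optimalValueDeriv A B xd ε T x h =
    1 / (N : ℝ) * ∑ i, 2 * (h i ⬝ᵥ (gramInv (A i) (B i) T *ᵥ deviation A B xd ε T x i)) := rfl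

/-- The minimizer at `y` is a competitor at `x`. Exchanging `x` and `y` gives the other half of the
envelope argument. -/
theorem optimalValue_sub_le (x y : State N n) :
    optimalValue A B xd ε T x - optimalValue A B xd ε T y ≤
      ∑ i, ∑ j, (costMatrix A B xd T x i j - costMatrix A B xd T y i j) *
        Pstar A B xd ε T y i j := by
  rw [← entropicCost_sub ε]
  exact sub_le_sub_right (entropicCost_optimalCoupling_le ε _ (Pstar_mem A B xd ε T y)) _

theorem exists_abs_sum_dotProduct_gramInv_le : ∃ κ : ℝ, 0 ≤ κ ∧ ∀ h : State N n,
    |1 / (N : ℝ) * ∑ i, h i ⬝ᵥ (gramInv (A i) (B i) T *ᵥ h i)| ≤ κ * ‖h‖ ^ 2 := by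
  refine ⟨1 / (N : ℝ) * ∑ i, ∑ a, ∑ b, |gramInv (A i) (B i) T a b|, by positivity, fun h => ?_⟩
  rw [abs_mul, abs_of_nonneg (by positivity), mul_assoc]
  refine mul_le_mul_of_nonneg_left ?_ (by positivity)
  rw [Finset.sum_mul]
  refine (Finset.abs_sum_le_sum_abs _ _).trans (Finset.sum_le_sum fun i _ => ?_)
  have hi := norm_le_pi_norm h i
  refine (abs_dotProduct_le _ _).trans ?_
  have h1 : ∑ a, |(gramInv (A i) (B i) T *ᵥ h i) a| ≤
      ‖h‖ * ∑ a, ∑ b, |gramInv (A i) (B i) T a b| := by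
    rw [Finset.mul_sum]
    refine Finset.sum_le_sum fun a _ => ?_
    rw [mulVec, dotProduct_comm]
    refine (abs_dotProduct_le _ _).trans ?_
    gcongr
  calc ‖h i‖ * ∑ a, |(gramInv (A i) (B i) T *ᵥ h i) a|
      ≤ ‖h‖ * (‖h‖ * ∑ a, ∑ b, |gramInv (A i) (B i) T a b|) := by gcongr
    _ = _ := by ring

variable {ε}

/-- The increment of the value lies between the cost increments weighted by `P*(x)` and by `P*(y)`.
These differ by `O(‖x - y‖²)` because `P*` is Lipschitz, and the second one has the claimed linear
part. -/
theorem hasFDerivAt_optimalValue (hε : 0 < ε) (y : State N n) :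
    HasFDerivAt (optimalValue A B xd ε T) (optimalValueDeriv A B xd ε T y) y := by
  obtain ⟨κ₁, hκ₁0, hκ₁⟩ := exists_abs_sum_costMatrix_sub_mul_le A B xd T
  obtain ⟨κ₂, hκ₂0, hκ₂⟩ := exists_sum_abs_Pstar_sub_le A B xd T hε
  obtain ⟨κ₃, hκ₃0, hκ₃⟩ := exists_abs_sum_dotProduct_gramInv_le A B T
  have hbound : ∀ x, |optimalValue A B xd ε T x - optimalValue A B xd ε T y -
      optimalValueDeriv A B xd ε T y (x - y)| ≤ (κ₁ * κ₂ + κ₃) * ‖x - y‖ ^ 2 := by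
    intro x
    have hupper := optimalValue_sub_le A B xd ε T x y
    have hlower := optimalValue_sub_le A B xd ε T y x
    have hexp := sum_costMatrix_sub_mul A B xd T (Pstar_mem A B xd ε T y) x y
    rw [Finset.sum_add_distrib, mul_add] at hexp
    change _ = optimalValueDeriv A B xd ε T y (x - y) +
      1 / (N : ℝ) * ∑ i, (x - y) i ⬝ᵥ (gramInv (A i) (B i) T *ᵥ (x - y) i) at hexp
    have hquad := abs_le.1 (hκ₃ (x - y))
    have hdiff := hκ₁ x y _ (Pstar_mem A B xd ε T x) _ (Pstar_mem A B xd ε T y)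
    have hdiff' := abs_le.1 (hdiff.trans
      (mul_le_mul_of_nonneg_left (hκ₂ x y) (mul_nonneg hκ₁0 (norm_nonneg _))))
    have hsplit : ∑ i, ∑ j, (costMatrix A B xd T x i j - costMatrix A B xd T y i j) *
          (Pstar A B xd ε T x i j - Pstar A B xd ε T y i j) =
        -∑ i, ∑ j, (costMatrix A B xd T y i j - costMatrix A B xd T x i j) *
          Pstar A B xd ε T x i j -
        ∑ i, ∑ j, (costMatrix A B xd T x i j - costMatrix A B xd T y i j) *
          Pstar A B xd ε T y i j := by
      simp only [← Finset.sum_neg_distrib, ← Finset.sum_sub_distrib]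
      exact Finset.sum_congr rfl fun i _ => Finset.sum_congr rfl fun j _ => by ring
    have hprod : 0 ≤ κ₁ * κ₂ * ‖x - y‖ ^ 2 := by positivity
    have hprod' : κ₁ * ‖x - y‖ * (κ₂ * ‖x - y‖) = κ₁ * κ₂ * ‖x - y‖ ^ 2 := by ring
    rw [hsplit, hprod'] at hdiff'
    rw [abs_le, add_mul]
    constructor <;> linarith [hquad.1, hquad.2, hdiff'.1, hdiff'.2]
  have hO : (fun x => optimalValue A B xd ε T x - optimalValue A B xd ε T y -
      optimalValueDeriv A B xd ε T y (x - y)) =O[𝓝 y] fun x => ‖x - y‖ ^ 2 :=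
    Asymptotics.IsBigO.of_bound (κ₁ * κ₂ + κ₃) (Filter.Eventually.of_forall fun x => by
      rw [Real.norm_eq_abs, norm_pow, norm_norm]
      exact hbound x)
  refine HasFDerivAt.of_isLittleO (hO.trans_isLittleO ?_)
  have h := Asymptotics.isLittleO_pow_sub_sub y (m := 2) (by norm_num)
  exact h

theorem isBounded_optimalValue_le (hε : 0 < ε) (hT : 0 < T)
    (hctrl : ∀ i, IsControllable (A i) (B i)) (c : ℝ) :
    Bornology.IsBounded {x | optimalValue A B xd ε T x ≤ c} := by
  set q : Fin N → (Fin n → ℝ) → ℝ := fun i v => v ⬝ᵥ (gramInv (A i) (B i) T *ᵥ v) with hq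
  have hq0 : ∀ i v, 0 ≤ q i v := fun i v => dotProduct_gramInv_mulVec_nonneg hT (hctrl i) v
  have hcost : ∀ x i j, q i (x i) / 2 - q i (xd j) ≤ costMatrix A B xd T x i j := by
    intro x i j
    -- The difference of the two sides is exactly `q i (x i - 2 xd j) / 2`.
    have h := hq0 i (x i - (2 : ℝ) • xd j)
    simp only [hq, costMatrix, of_apply, mulVec_sub, mulVec_smul, sub_dotProduct, dotProduct_sub,
      smul_dotProduct, dotProduct_smul, smul_eq_mul] at h ⊢
    rw [dotProduct_gramInv_mulVec_comm T _ _ (xd j) (x i)] at h ⊢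
    linarith
  set D : ℝ := ∑ i, ∑ j, (q i (xd j) + ε) with hD
  set R : ℝ := 2 * N * |c + D| with hR
  have hqR : ∀ x, optimalValue A B xd ε T x ≤ c → ∀ i, q i (x i) ≤ R := by
    intro x hx i
    have hP := Pstar_mem A B xd ε T x
    have hterm : ∀ i j, Pstar A B xd ε T x i j * (q i (x i) / 2) - (q i (xd j) + ε) ≤
        costMatrix A B xd T x i j * Pstar A B xd ε T x i j +
          ε * (Pstar A B xd ε T x i j * (Real.log (Pstar A B xd ε T x i j) - 1)) := by
      intro i j
      have hmem := mem_Icc_of_mem_couplings hP i j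
      have h1 := mul_le_mul_of_nonneg_left (hcost x i j) hmem.1
      have h2 := mul_le_mul_of_nonneg_left (neg_one_le_mul_log hmem.1) hε.le
      have h3 := mul_le_of_le_one_left (hq0 i (xd j)) hmem.2
      rw [mul_sub] at h1
      linarith
    have hsum : ∑ i, (1 / (N : ℝ)) * (q i (x i) / 2) - D ≤ c := by
      refine le_trans ?_ hx
      rw [optimalValue, entropicCost_eq, hD, ← Finset.sum_sub_distrib]
      refine Finset.sum_le_sum fun i _ => ?_
      rw [← hP.2.1 i, Finset.sum_mul, ← Finset.sum_sub_distrib]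
      exact Finset.sum_le_sum fun j _ => hterm i j
    have hN : (0 : ℝ) < N := by exact_mod_cast i.pos
    have hsingle := Finset.single_le_sum (f := fun i => (1 / (N : ℝ)) * (q i (x i) / 2))
      (fun k _ => mul_nonneg (by positivity) (div_nonneg (hq0 k _) two_pos.le))
      (Finset.mem_univ i)
    have habs := le_abs_self (c + D)
    have h1 : q i (x i) / (2 * N) ≤ |c + D| := by
      have : (1 / (N : ℝ)) * (q i (x i) / 2) = q i (x i) / (2 * N) := by field_simp
      rw [← this]
      linarith
    rw [div_le_iff₀ (by positivity)] at h1
    linarith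
  have hR0 : 0 ≤ R := by positivity
  set S : ℝ := ∑ i, ∑ a, |gramian (A i) (B i) T a a| with hS
  have hS0 : 0 ≤ S := by positivity
  refine isBounded_iff_forall_norm_le.2 ⟨S * R + 1, fun x hx => ?_⟩
  refine (pi_norm_le_iff_of_nonneg (by positivity)).2 fun i =>
    (pi_norm_le_iff_of_nonneg (by positivity)).2 fun a => ?_
  have h1 := sq_le_gramian_mul_dotProduct hT (hctrl i) (x i) a
  have h2 : gramian (A i) (B i) T a a ≤ S :=
    (le_abs_self _).trans <| (Finset.single_le_sum
      (f := fun a => |gramian (A i) (B i) T a a|) (fun _ _ => abs_nonneg _)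
      (Finset.mem_univ a)).trans (Finset.single_le_sum
      (f := fun i => ∑ a, |gramian (A i) (B i) T a a|)
      (fun _ _ => Finset.sum_nonneg fun _ _ => abs_nonneg _) (Finset.mem_univ i))
  have h3 : x i a ^ 2 ≤ S * R :=
    h1.trans (mul_le_mul h2 (hqR x hx i) (hq0 i _) hS0)
  rw [Real.norm_eq_abs]
  nlinarith [sq_abs (x i a), sq_nonneg (|x i a| - 1), abs_nonneg (x i a)]

theorem optimalValueDeriv_closedLoopField (hT : 0 < T)
    (hctrl : ∀ i, IsControllable (A i) (B i)) (x : State N n) :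
    optimalValueDeriv A B xd ε T x (closedLoopField A B xd ε T x) =
      -(1 / (N : ℝ) * ∑ i,
        (((B i)ᵀ *ᵥ (gramInv (A i) (B i) T *ᵥ deviation A B xd ε T x i)) ⬝ᵥ
          ((B i)ᵀ *ᵥ (gramInv (A i) (B i) T *ᵥ deviation A B xd ε T x i)) +
        ((B i)ᵀ *ᵥ (NormedSpace.exp (-(T • (A i)ᵀ)) *ᵥ
            (gramInv (A i) (B i) T *ᵥ deviation A B xd ε T x i))) ⬝ᵥ
          ((B i)ᵀ *ᵥ (NormedSpace.exp (-(T • (A i)ᵀ)) *ᵥ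
            (gramInv (A i) (B i) T *ᵥ deviation A B xd ε T x i))))) := by
  rw [optimalValueDeriv_apply, ← mul_neg, ← Finset.sum_neg_distrib]
  congr 1
  refine Finset.sum_congr rfl fun i _ => ?_
  rw [← two_mul_dotProduct_closedLoop hT (hctrl i), dotProduct_comm]
  rfl

theorem optimalValueDeriv_closedLoopField_nonpos (hT : 0 < T)
    (hctrl : ∀ i, IsControllable (A i) (B i)) (x : State N n) :
    optimalValueDeriv A B xd ε T x (closedLoopField A B xd ε T x) ≤ 0 := by
  rw [optimalValueDeriv_closedLoopField A B xd T hT hctrl, neg_nonpos]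
  exact mul_nonneg (by positivity) (Finset.sum_nonneg fun i _ => add_nonneg
    (Finset.sum_nonneg fun _ _ => mul_self_nonneg _)
    (Finset.sum_nonneg fun _ _ => mul_self_nonneg _))

theorem mem_stationarySet_of_optimalValueDeriv_eq_zero (hT : 0 < T)
    (hctrl : ∀ i, IsControllable (A i) (B i)) {x : State N n}
    (hx : optimalValueDeriv A B xd ε T x (closedLoopField A B xd ε T x) = 0) :
    x ∈ stationarySet A B xd ε T := by
  have hsq : ∀ v : Fin m → ℝ, 0 ≤ v ⬝ᵥ v := fun v =>
    Finset.sum_nonneg fun _ _ => mul_self_nonneg _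
  intro i
  have hN : (1 / (N : ℝ)) ≠ 0 := by have := i.pos; positivity
  rw [optimalValueDeriv_closedLoopField A B xd T hT hctrl, neg_eq_zero,
    mul_eq_zero_iff_left hN,
    Finset.sum_eq_zero_iff_of_nonneg fun i _ => add_nonneg (hsq _) (hsq _)] at hx
  have h := (add_eq_zero_iff_of_nonneg (hsq _) (hsq _)).1 (hx i (Finset.mem_univ i))
  exact ⟨dotProduct_self_eq_zero.1 h.1, dotProduct_self_eq_zero.1 h.2⟩

theorem closedLoopField_eq_driftField {x : State N n} (hx : x ∈ stationarySet A B xd ε T) :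
    closedLoopField A B xd ε T x = driftField A B xd ε T x := by
  funext i
  rw [closedLoopField, driftField, sub_mulVec, ← mulVec_mulVec, ← mulVec_mulVec, (hx i).1,
    mulVec_zero, sub_zero]

end Lyapunov

/-! ### The largest invariant set and the conclusion -/

theorem isInvariantSet_sUnion {E : Type*} [NormedAddCommGroup E] [NormedSpace ℝ E] {f : E → E}
    {𝒮 : Set (Set E)} (h : ∀ S ∈ 𝒮, IsInvariantSet f S) : IsInvariantSet f (⋃₀ 𝒮) := by
  rintro x₀ ⟨S, hS, hx₀⟩
  exact ⟨(h S hS x₀ hx₀).1, fun x hx h0 t => ⟨S, hS, (h S hS x₀ hx₀).2 x hx h0 t⟩⟩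

end SinkhornMPC

theorem theorem1 (N n m : ℕ)
    (A : Fin N → Matrix (Fin n) (Fin n) ℝ) (B : Fin N → Matrix (Fin n) (Fin m) ℝ)
    (xd : SinkhornMPC.State N n) (ε T : ℝ) (hε : 0 < ε) (hT : 0 < T)
    (hctrl : ∀ i, SinkhornMPC.IsControllable (A i) (B i))
    (hequil : ∀ i j, ∃ u : Fin m → ℝ, A i *ᵥ xd j + B i *ᵥ u = 0) :
    ∃ L : Set (SinkhornMPC.State N n),
      IsGreatest {S | S ⊆ SinkhornMPC.stationarySet A B xd ε T ∧
        SinkhornMPC.IsInvariantSet (SinkhornMPC.driftField A B xd ε T) S} L ∧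
      ∀ x₀ : SinkhornMPC.State N n,
        (∃ x : ℝ → SinkhornMPC.State N n,
          SinkhornMPC.IsForwardSolution (SinkhornMPC.closedLoopField A B xd ε T) x ∧
            x 0 = x₀) ∧
        ∀ x : ℝ → SinkhornMPC.State N n,
          SinkhornMPC.IsForwardSolution (SinkhornMPC.closedLoopField A B xd ε T) x →
          x 0 = x₀ → SinkhornMPC.ConvergesToSet x L := by
  obtain ⟨K, hK⟩ : ∃ K, LipschitzWith K (SinkhornMPC.closedLoopField A B xd ε T) :=
    SinkhornMPC.exists_lipschitzWith_mulVec_deviation A B xd T hε _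
  obtain ⟨K', hK'⟩ : ∃ K, LipschitzWith K (SinkhornMPC.driftField A B xd ε T) :=
    SinkhornMPC.exists_lipschitzWith_mulVec_deviation A B xd T hε A
  refine ⟨⋃₀ {S | S ⊆ SinkhornMPC.stationarySet A B xd ε T ∧
      SinkhornMPC.IsInvariantSet (SinkhornMPC.driftField A B xd ε T) S},
    ⟨⟨sUnion_subset fun S hS => hS.1, SinkhornMPC.isInvariantSet_sUnion fun S hS => hS.2⟩,
      fun S hS => subset_sUnion_of_mem hS⟩,
    fun x₀ => ⟨SinkhornMPC.exists_isForwardSolution hK x₀, fun x hx _ => ?_⟩⟩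
  -- LaSalle's principle is applied to the two-sided solution `y`, with which `x` coincides only for
  -- nonnegative times; hence the `max t₀ 0` below.
  obtain ⟨y, hy, hy0⟩ := SinkhornMPC.exists_isGlobalSolution hK (x 0)
  obtain ⟨S, hSM, hSinv, hSconv⟩ := SinkhornMPC.exists_isInvariantSet_convergesToSet hK hK'
    (SinkhornMPC.hasFDerivAt_optimalValue A B xd T hε)
    (SinkhornMPC.optimalValueDeriv_closedLoopField_nonpos A B xd T hT hctrl)
    (fun z hz => by
      have hmem := SinkhornMPC.mem_stationarySet_of_optimalValueDeriv_eq_zero A B xd T hT hctrl hz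
      exact ⟨hmem, SinkhornMPC.closedLoopField_eq_driftField A B xd T hmem⟩)
    (SinkhornMPC.isBounded_optimalValue_le A B xd T hε hT hctrl) hy
  intro δ hδ
  obtain ⟨t₀, ht₀⟩ := hSconv δ hδ
  refine ⟨max t₀ 0, fun t ht => ?_⟩
  obtain ⟨p, hp, hd⟩ := ht₀ t ((le_max_left _ _).trans ht)
  refine ⟨p, ⟨S, ⟨hSM, hSinv⟩, hp⟩, ?_⟩
  rwa [hx.unique hK hy.isForwardSolution hy0.symm ((le_max_right _ _).trans ht)]
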